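/- For an algebraic number $\alpha$ with minimal polynomial $P$ over $\mathbb{Z}$ with leading coefficient $a_0>0$, let $H(\alpha)=\bigl(a_0\prod_{P(z)=0}\max\{1,|z|\}\bigr)^{1/\deg P}$ be its multiplicative height. Let $f$ be analytic on the open unit disk $\mathbb{D}$ with $|f(z)|\le 1$ there, let $S\subseteq\mathbb{D}$ be a set containing the real interval $(0,1)$, and let $a>0$, $b>1$ be real numbers with $|f(z)|\le a\,b^{-1/(1-|z|)}$ for all $z\in S$ (in particular, this holds if the inequality is strict). For an integer $d\ge 2$ and a real number $H$, let $N_{f,S}(d,H)$ be the number of algebraic $\alpha\in S$ such that $f(\alpha)$ is algebraic and non-zero, $[\mathbb{Q}(\alpha,f(\alpha)):\mathbb{Q}]\le d$, $H(\alpha)\le H$ and $H(f(\alpha))\le H$. (1) There is a constant $c_{a,b}>0$, depending only on $a,b$ and effectively computable from them, such that for all such $f,S$ and all $d\ge 2$, $H\ge e$, $$N_{f,S}(d,H)\le c_{a,b}\,d^9(\log d)^2(\log H)^9 .$$ (2) For $0<r<1$ there is a constant $c_{a,b,r}>0$, depending only on $a,b,r$ and effectively computable from them, such that for all such $f,S$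 and all $d\ge 2$, $H\ge e$, the number of those $\alpha$ counted by $N_{f,S}(d,H)$ that satisfy $|\alpha|\le r$ is at most $c_{a,b,r}\,d^4(\log d)^2(\log H)^4$. (3) There is an absolute effectively computable constant $c>0$ such that, whenever moreover $a\ge b^e$ and $a\ge e$, one has, with $l_{a,b}=\log a/\log b$, for all $d\ge 2$ and $H\ge e^e$, $$N_{f,S}(d,H)\le c\,l_{a,b}^6(\log l_{a,b})^3\,d^9(\log d)^2(\log H)^9 .$$ In particular all the sets counted are finite. -/

import Mathlib

noncomputable section

/-- The exponent `φ(z) = 1 / (1 - |z|)` for `z` in the open unit disk. -/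
def diskPhi (z : ℂ) : ℝ := 1 / (1 - ‖z‖)

/-- The minimal polynomial over the integers of an algebraic number: the primitive integer
polynomial, unique up to sign, proportional to the minimal polynomial over `ℚ`. -/
def intMinpoly (α : ℂ) : Polynomial ℤ :=
  (IsLocalization.integerNormalization (nonZeroDivisors ℤ) (minpoly ℚ α)).primPart

/-- The (absolute) multiplicative height of an algebraic number `α`: the `deg P`-th root of
`|leading coefficient of P| * ∏ max 1 |z|`, where `P` is the minimal polynomial of `α` over the
integers and the product runs over the complex roots `z` of `P`. -/
def algHeight (α : ℂ) : ℝ :=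
  (|((intMinpoly α).leadingCoeff : ℝ)| *
      (((intMinpoly α).map (Int.castRingHom ℂ)).roots.map (fun z => max 1 ‖z‖)).prod) ^
    (1 / ((intMinpoly α).natDegree : ℝ))

/-- `f` is analytic on the open unit disk and bounded by `1` there, `S` is a subset of the disk
that contains the real interval `(0, 1)`, and `|f(z)| ≤ a * b ^ (-φ(z))` for `z ∈ S`. -/
structure DecaysOn (f : ℂ → ℂ) (S : Set ℂ) (a b : ℝ) : Prop where
  analytic : AnalyticOnNhd ℂ f (Metric.ball 0 1)
  norm_le_one : ∀ z ∈ Metric.ball (0 : ℂ) 1, ‖f z‖ ≤ 1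
  subset_disk : S ⊆ Metric.ball 0 1
  interval_subset : ∀ x : ℝ, 0 < x → x < 1 → (x : ℂ) ∈ S
  decay : ∀ z ∈ S, ‖f z‖ ≤ a * b ^ (-diskPhi z)

/-- The algebraic `α ∈ S` such that `f(α)` is algebraic and non-zero,
`[ℚ(α, f(α)) : ℚ] ≤ d`, and `α` and `f(α)` have height at most `H`. -/
def algPoints (f : ℂ → ℂ) (S : Set ℂ) (d : ℕ) (H : ℝ) : Set ℂ :=
  {α | α ∈ S ∧ IsAlgebraic ℚ α ∧ IsAlgebraic ℚ (f α) ∧ f α ≠ 0 ∧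
    Module.finrank ℚ (IntermediateField.adjoin ℚ ({α, f α} : Set ℂ)) ≤ d ∧
    algHeight α ≤ H ∧ algHeight (f α) ≤ H}

/-- The set `A` is finite and has at most `B` elements. -/
def CardAtMost (A : Set ℂ) (B : ℝ) : Prop := A.Finite ∧ (A.ncard : ℝ) ≤ B

/-- A triple `(p, q, s)` of natural numbers codes the rational number `(p - q) / (s + 1)`. -/
abbrev RatCode : Type := ℕ × ℕ × ℕ

def RatCode.val (c : RatCode) : ℝ := ((c.1 : ℝ) - (c.2.1 : ℝ)) / ((c.2.2 : ℝ) + 1)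

/-- A pair of coded rationals codes the open interval between them. -/
abbrev IntervalCode : Type := RatCode × RatCode

def IntervalCode.toSet (I : IntervalCode) : Set ℝ := Set.Ioo (RatCode.val I.1) (RatCode.val I.2)

/-- Effective computability, in the sense of computable analysis, of a real function `F` of `n`
real variables on the domain `D`: there is a recursively enumerable set of pairs `(B, J)`,
with `B` a rational box and `J` a rational interval, such that `F` maps `B ∩ D` into `J` for each
of them, and such that every `x ∈ D` lies in boxes `B` whose `J` is arbitrarily short. Thus
an algorithm finds `F x` to any accuracy from sufficiently good rational approximations to `x`. -/
def EffectivelyComputableOn {n : ℕ} (D : Set (Fin n → ℝ)) (F : (Fin n → ℝ) → ℝ) : Prop :=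
  ∃ E : (Fin n → IntervalCode) × IntervalCode → Prop,
    REPred E ∧
    (∀ B J, E (B, J) → ∀ x ∈ D, (∀ i, x i ∈ IntervalCode.toSet (B i)) →
      F x ∈ IntervalCode.toSet J) ∧
    (∀ x ∈ D, ∀ ε : ℝ, 0 < ε → ∃ B J, E (B, J) ∧ (∀ i, x i ∈ IntervalCode.toSet (B i)) ∧
      RatCode.val J.2 - RatCode.val J.1 < ε)

/-- An effectively computable real number (the case of no variables). -/
def EffectivelyComputableReal (c : ℝ) : Prop :=
  EffectivelyComputableOn (Set.univ : Set (Fin 0 → ℝ)) (fun _ => c)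

/-- `l_{a,b} = log a / log b`. -/
def logRatio (a b : ℝ) : ℝ := Real.log a / Real.log b

end

/-! The argument is the Gelfond–Masser method of auxiliary polynomials. Choose an integer `h`
comparable to `log H` with `H ≤ 4 ^ h`.

Among the `T ^ 2` functions `z ^ i * f z ^ j`, with `T` of order `d ^ 2 * h`, the box principle
applied to Taylor coefficients gives a nonzero integer combination `P(z, f z)` that is extremely
small on a small disc (`exists_int_combination_small`). At a counted point `α` of this disc, the
Liouville inequality (`one_le_pow_mul_norm_eval`) says that a nonzero value `P(α, f α)` cannot be
that small. Hence `P(z, f z)` vanishes at every counted point of the disc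
(`exists_polynomial_vanishing`), and it remains to bound its zeros.

Zero counting needs one point where the function is not small. The decay of `f` on `(0, 1)` provides
it. After division by the largest power of `f`, which loses no zero with `f α ≠ 0`, the function is
`A(z) + O(f z)` with `A ≠ 0` an integer polynomial in `z` alone. At a rational point `x = 1 - 1/q`
that is not a root of `A`, `|A(x)| ≥ q ^ (-T)`, whereas `f x` is at most `a * b ^ (-q)`. So for `q`
large enough `A` dominates. A Jensen bound obtained from Blaschke factors (`card_zeros_le`) then
limits the zeros in `|z| ≤ 1 - 1/R` (`card_zeros_polynomial_le`).

Covering `|z| ≤ 1 - 1/R` by `O(R ^ 2)` small discs gives a bound of order `R ^ 3`, which settles the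
case `|α| ≤ r`. For the full count, the nonzero algebraic number `f α` has absolute value at least
`H ^ (-2d)`; against the decay on `S` this keeps `α` at distance at least `1/R` from the unit
circle, with `R` of order `d * l * log H`.

For general `a`, `b` one enlarges `a` and majorizes the resulting constant by a rational function of
`a`, `b`, `r`. Its effective computability is then interval arithmetic with rational endpoints. -/

/-! ### Integrality of products of conjugates, heights, and the Liouville inequality. -/

open Polynomial in
/-- Dividing a polynomial with integral coefficients by a linear factor `X - α` leaves a polynomial
with integral coefficients. -/
theorem isIntegral_coeff_of_X_sub_C_mul {K : Type*} [Field K] (α : K) (Q : K[X])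
    (h : ∀ i, IsIntegral ℤ (((X - C α) * Q).coeff i)) : ∀ i, IsIntegral ℤ (Q.coeff i) := by
  induction hn : Q.natDegree using Nat.strong_induction_on generalizing Q with
  | _ n ih =>
  by_cases hQ : Q = 0
  · intro i; simpa [hQ] using isIntegral_zero
  set m := Q.natDegree with hm
  have hlead : IsIntegral ℤ Q.leadingCoeff := by
    have := h (m + 1)
    rw [sub_mul, coeff_sub, coeff_X_mul, coeff_C_mul, coeff_eq_zero_of_natDegree_lt (p := Q)
      (n := m + 1) (by omega)] at this
    simpa [hm] using this
  -- `α` is a root of a polynomial over the integral closure of `ℤ` whose leading coefficient is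
  -- that of `Q`; leading coefficient times root is always integral.
  have hle : IsIntegral ℤ (Q.leadingCoeff * α) := by
    have hmon : ((X - C α) * Q).leadingCoeff = Q.leadingCoeff := by simp
    have hl : (X - C α) * Q ∈ lifts (algebraMap (integralClosure ℤ K) K) := by
      rw [lifts_iff_coeff_lifts]
      intro i
      exact ⟨⟨_, h i⟩, rfl⟩
    obtain ⟨q, hq⟩ := hl
    have hq' : q.map (algebraMap (integralClosure ℤ K) K) = (X - C α) * Q := by simpa using hq
    have h1 := isIntegral_leadingCoeff_smul q α (by
      rw [aeval_def, ← eval_map, hq']; simp)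
    have h2 : IsIntegral ℤ (q.leadingCoeff • α) := isIntegral_trans _ h1
    have h3 : algebraMap (integralClosure ℤ K) K q.leadingCoeff = Q.leadingCoeff := by
      rw [← hmon, ← hq', leadingCoeff_map_of_injective]
      exact FaithfulSMul.algebraMap_injective _ _
    rw [Algebra.smul_def, h3] at h2
    exact h2
  have hQe : Q = Q.eraseLead + C Q.leadingCoeff * X ^ m := by
    rw [hm]; exact (eraseLead_add_C_mul_X_pow Q).symm
  -- Dropping the leading term of `Q` changes the product only by integral coefficients, so the
  -- induction on the degree applies to `Q.eraseLead`.
  have hprod : (X - C α) * Q.eraseLead =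
      (X - C α) * Q - C Q.leadingCoeff * X ^ (m + 1) + C (Q.leadingCoeff * α) * X ^ m := by
    have h1 : Q.eraseLead = Q - C Q.leadingCoeff * X ^ m := eq_sub_of_add_eq hQe.symm
    rw [h1, C_mul]
    ring
  have herase : ∀ i, IsIntegral ℤ (Q.eraseLead.coeff i) := by
    by_cases h0 : Q.eraseLead = 0
    · intro i; simpa [h0] using isIntegral_zero
    refine ih Q.eraseLead.natDegree ?_ Q.eraseLead ?_ rfl
    · rw [← hn]
      have := eraseLead_natDegree_lt_or_eraseLead_eq_zero Q
      tauto
    · intro i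
      rw [hprod, coeff_add, coeff_sub, coeff_C_mul, coeff_C_mul, coeff_X_pow, coeff_X_pow]
      refine ((h i).sub ?_).add ?_
      · split_ifs <;> simp [hlead, isIntegral_zero]
      · split_ifs <;> simp [hle, isIntegral_zero]
  intro i
  rw [hQe, coeff_add, coeff_C_mul, coeff_X_pow]
  refine (herase i).add ?_
  split_ifs <;> simp [hlead, isIntegral_zero]

open Polynomial in
/-- If `c * ∏ (X - x i)` has integral coefficients, then `c` times any subproduct of the `x i` is
integral. -/
theorem isIntegral_mul_prod_roots {K ι : Type*} [Field K] [Fintype ι] [DecidableEq ι]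
    (c : K) (x : ι → K) (h : ∀ k, IsIntegral ℤ ((C c * ∏ i, (X - C (x i))).coeff k))
    (s : Finset ι) : IsIntegral ℤ (c * ∏ i ∈ s, x i) := by
  -- Linear factors are removed one at a time. Once those outside `s` are gone, the constant
  -- coefficient is the desired number up to sign.
  have key : ∀ t : Finset ι, ∀ k, IsIntegral ℤ ((C c * ∏ i ∈ tᶜ, (X - C (x i))).coeff k) := by
    intro t
    induction t using Finset.induction_on with
    | empty => simpa using h
    | insert a t ha ih =>
      refine isIntegral_coeff_of_X_sub_C_mul (x a) _ ?_
      have : (X - C (x a)) * (C c * ∏ i ∈ (insert a t)ᶜ, (X - C (x i))) =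
          C c * ∏ i ∈ tᶜ, (X - C (x i)) := by
        have h1 : tᶜ = insert a (insert a t)ᶜ := by
          ext j; simp only [Finset.mem_compl, Finset.mem_insert]; by_cases hj : j = a
          · subst hj; simp [ha]
          · simp [hj]
        rw [h1, Finset.prod_insert (by simp)]
        ring
      rw [this]
      exact ih
  have h0 := key sᶜ 0
  rw [compl_compl, mul_coeff_zero, coeff_C_zero, coeff_zero_prod] at h0
  simp only [coeff_sub, coeff_X_zero, coeff_C_zero, zero_sub, Finset.prod_neg] at h0
  rw [mul_left_comm] at h0
  rcases neg_one_pow_eq_or K s.card with h1 | h1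
  · simpa [h1] using h0
  · rw [h1] at h0
    simpa using h0.neg

/-- If `c` times every subproduct of the `x i` is integral, then so is `c ^ T` times every monomial
in the `x i` with exponents at most `T`. -/
theorem isIntegral_pow_mul_prod_pow {K ι : Type*} [Field K] [Fintype ι] [DecidableEq ι]
    (c : K) (x : ι → K) (h : ∀ s : Finset ι, IsIntegral ℤ (c * ∏ i ∈ s, x i))
    (T : ℕ) (e : ι → ℕ) (he : ∀ i, e i ≤ T) : IsIntegral ℤ (c ^ T * ∏ i, x i ^ e i) := by
  -- Layer-cake decomposition: layer `t` contains the indices with `t < e i`, and each of the `T`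
  -- layers uses one factor `c`.
  have : c ^ T * ∏ i, x i ^ e i =
      ∏ t ∈ Finset.range T, (c * ∏ i ∈ Finset.univ.filter (fun i => t < e i), x i) := by
    rw [Finset.prod_mul_distrib, Finset.prod_const, Finset.card_range]
    congr 1
    simp_rw [Finset.prod_filter]
    rw [Finset.prod_comm]
    refine Finset.prod_congr rfl fun i _ => ?_
    rw [← Finset.prod_filter, Finset.prod_const]
    congr 1
    have : (Finset.range T).filter (fun t => t < e i) = Finset.range (e i) := by
      ext t; simp only [Finset.mem_filter, Finset.mem_range]
      have := he i; omega
    rw [this, Finset.card_range]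
  rw [this]
  exact IsIntegral.prod _ fun t _ => h _

open IntermediateField Module in
/-- A product over the embeddings of a finite separable extension `K` of a function of the image of
`x` is a power of the product over the conjugates of `x`. -/
theorem prod_embeddings_eq_prod_roots_pow {F K M : Type*} (E : Type*) [Field F] [Field K]
    [Algebra F K] [FiniteDimensional F K] [Algebra.IsSeparable F K] [Field E] [Algebra F E]
    [IsAlgClosed E] [CommMonoid M] (x : K) (g : E → M) :
    ∏ σ : K →ₐ[F] E, g (σ x) =
      (((minpoly F x).aroots E).map g).prod ^ finrank F⟮x⟯ K := by
  classical
  have hx : IsIntegral F x := Algebra.IsIntegral.isIntegral x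
  set pb := adjoin.powerBasis hx
  have hgen : pb.gen = AdjoinSimple.gen F x := adjoin.powerBasis_gen hx
  have hmin : minpoly F pb.gen = minpoly F x := by
    rw [hgen]; exact minpoly_gen F x
  have h1 : (((minpoly F x).aroots E).map g).prod = ∏ σ : F⟮x⟯ →ₐ[F] E, g (σ pb.gen) := by
    have hnd : ((minpoly F x).aroots E).Nodup :=
      Polynomial.nodup_roots (Polynomial.Separable.map (Algebra.IsSeparable.isSeparable F x))
    calc (((minpoly F x).aroots E).map g).prod
        = ∏ y ∈ ((minpoly F x).aroots E).toFinset, g y := by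
          rw [Finset.prod_eq_multiset_prod, Multiset.toFinset_val, Multiset.dedup_eq_self.mpr hnd]
      _ = ∏ y : {y // y ∈ (minpoly F pb.gen).aroots E}, g y := by
          rw [hmin]
          refine (Finset.prod_subtype _ (fun y => ?_) g)
          rw [Multiset.mem_toFinset]
      _ = _ := by
          refine (Fintype.prod_equiv pb.liftEquiv' _ _ fun σ => ?_).symm
          simp [PowerBasis.liftEquiv'_apply_coe]
  rw [h1]
  -- Embeddings of `K` are grouped by their restriction to `F⟮x⟯`; each restriction has `[K : F⟮x⟯]`
  -- extensions.
  rw [Fintype.prod_equiv algHomEquivSigma (fun σ : K →ₐ[F] E => g (σ x)) fun σ => g (σ.1 pb.gen),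
    ← Finset.univ_sigma_univ, Finset.prod_sigma, ← Finset.prod_pow]
  · refine Finset.prod_congr rfl fun σ _ => ?_
    let : Algebra F⟮x⟯ E := σ.toRingHom.toAlgebra
    simp_rw [Finset.prod_const]
    congr
    exact AlgHom.card F⟮x⟯ K E
  · intro σ
    simp only [algHomEquivSigma, Equiv.coe_fn_mk, AlgHom.domRestrict, AlgHom.comp_apply,
      IsScalarTower.coe_toAlgHom', hgen]
    rfl

-- Clearing denominators and dividing by the content multiply the monic rational polynomial by one
-- nonzero rational number, which must therefore be the new leading coefficient.
open Polynomial in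
theorem intMinpoly_map {α : ℂ} (hα : IsAlgebraic ℚ α) :
    (intMinpoly α).map (Int.castRingHom ℂ) =
      C ((intMinpoly α).leadingCoeff : ℂ) * (minpoly ℚ α).map (algebraMap ℚ ℂ) ∧
    (intMinpoly α).leadingCoeff ≠ 0 ∧ (intMinpoly α).natDegree = (minpoly ℚ α).natDegree := by
  set N := IsLocalization.integerNormalization (nonZeroDivisors ℤ) (minpoly ℚ α) with hN
  have hmon : (minpoly ℚ α).Monic := minpoly.monic hα.isIntegral
  obtain ⟨b, hb, hbN⟩ := IsLocalization.integerNormalization_spec (nonZeroDivisors ℤ) (minpoly ℚ α)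
  rw [← hN] at hbN
  have hb0 : b ≠ 0 := nonZeroDivisors.ne_zero hb
  have hN0 : N ≠ 0 := by
    rw [hN, Ne, IsLocalization.integerNormalization_eq_zero_iff le_rfl]
    exact hmon.ne_zero
  have hc0 : N.content ≠ 0 := by rwa [Ne, content_eq_zero_iff]
  have hI : intMinpoly α = N.primPart := rfl
  have h1 : C (N.content : ℚ) * (intMinpoly α).map (algebraMap ℤ ℚ) = C (b : ℚ) * minpoly ℚ α := by
    have h2 := congrArg (Polynomial.map (algebraMap ℤ ℚ)) N.eq_C_content_mul_primPart
    rw [hbN, Polynomial.map_mul, map_C] at h2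
    rw [hI]
    simpa [smul_eq_C_mul] using h2.symm
  have hcq : (N.content : ℚ) ≠ 0 := by exact_mod_cast hc0
  have h3 : (intMinpoly α).map (algebraMap ℤ ℚ) = C ((b : ℚ) / N.content) * minpoly ℚ α := by
    have : C ((N.content : ℚ)⁻¹) * (C (N.content : ℚ) * (intMinpoly α).map (algebraMap ℤ ℚ)) =
      C ((N.content : ℚ)⁻¹) * (C (b : ℚ) * minpoly ℚ α) := by rw [h1]
    rw [← mul_assoc, ← C_mul, inv_mul_cancel₀ hcq, C_1, one_mul, ← mul_assoc, ← C_mul] at this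
    rw [this, div_eq_inv_mul]
  have hinj : Function.Injective (algebraMap ℤ ℚ) := FaithfulSMul.algebraMap_injective _ _
  have hl : ((intMinpoly α).leadingCoeff : ℚ) = (b : ℚ) / N.content := by
    have := leadingCoeff_map_of_injective hinj (p := intMinpoly α)
    rw [h3, leadingCoeff_mul, leadingCoeff_C, hmon.leadingCoeff, mul_one] at this
    simpa using this.symm
  have hne : (b : ℚ) / N.content ≠ 0 := div_ne_zero (by exact_mod_cast hb0) hcq
  refine ⟨?_, ?_, ?_⟩
  · have h4 := congrArg (Polynomial.map (algebraMap ℚ ℂ)) h3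
    rw [Polynomial.map_map, Polynomial.map_mul, map_C, ← hl] at h4
    have h5 : (algebraMap ℚ ℂ).comp (algebraMap ℤ ℚ) = Int.castRingHom ℂ := RingHom.ext_int _ _
    rw [h5] at h4
    simpa using h4
  · intro h
    rw [h] at hl
    exact hne (by simpa using hl.symm)
  · have := natDegree_map_eq_of_injective hinj (intMinpoly α)
    rw [← this, h3, natDegree_C_mul hne]

open Polynomial in
theorem intMinpoly_roots {α : ℂ} (hα : IsAlgebraic ℚ α) :
    ((intMinpoly α).map (Int.castRingHom ℂ)).roots = (minpoly ℚ α).aroots ℂ := by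
  obtain ⟨h1, h2, -⟩ := intMinpoly_map hα
  rw [h1, roots_C_mul _ (by exact_mod_cast h2), aroots_def]

-- The embeddings of `K` reach each conjugate of `x` exactly `[K : ℚ⟮x⟯]` times. This puts the
-- heights of `α` and `f α` on one common field, as the Liouville inequality requires.
open IntermediateField Module in
theorem leadingCoeff_pow_mul_prod_max {K : Type*} [Field K] [Algebra ℚ K] [FiniteDimensional ℚ K]
    (σ₀ : K →ₐ[ℚ] ℂ) (x : K) :
    |((intMinpoly (σ₀ x)).leadingCoeff : ℝ)| ^ finrank ℚ⟮x⟯ K * ∏ σ : K →ₐ[ℚ] ℂ, max 1 ‖σ x‖ =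
      algHeight (σ₀ x) ^ finrank ℚ K := by
  have hx : IsIntegral ℚ x := Algebra.IsIntegral.isIntegral x
  have hx' : IsAlgebraic ℚ (σ₀ x) := (hx.map σ₀).isAlgebraic
  have hmin : minpoly ℚ (σ₀ x) = minpoly ℚ x := minpoly.algHom_eq σ₀ σ₀.injective x
  have hdeg : (intMinpoly (σ₀ x)).natDegree = finrank ℚ ℚ⟮x⟯ := by
    rw [(intMinpoly_map hx').2.2, hmin, adjoin.finrank hx]
  have hpos : 0 < finrank ℚ ℚ⟮x⟯ := finrank_pos
  rw [prod_embeddings_eq_prod_roots_pow ℂ x (fun z => max 1 ‖z‖), ← mul_pow,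
    ← finrank_mul_finrank ℚ ℚ⟮x⟯ K, pow_mul]
  congr 1
  rw [algHeight, intMinpoly_roots hx', hmin, hdeg, one_div, Real.rpow_inv_natCast_pow _ hpos.ne']
  refine mul_nonneg (abs_nonneg _) (Multiset.prod_nonneg ?_)
  intro a ha
  obtain ⟨z, -, rfl⟩ := Multiset.mem_map.1 ha
  positivity

-- With this power of the leading coefficient in front, `∏ σ, (X - C (σ x))` becomes a power of
-- `intMinpoly`, hence has integer coefficients.
open IntermediateField Module Polynomial in
theorem isIntegral_leadingCoeff_mul_prod_embeddings {K : Type*} [Field K] [Algebra ℚ K]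
    [FiniteDimensional ℚ K] (σ₀ : K →ₐ[ℚ] ℂ) (x : K) (s : Finset (K →ₐ[ℚ] ℂ)) :
    IsIntegral ℤ (((intMinpoly (σ₀ x)).leadingCoeff : ℂ) ^ finrank ℚ⟮x⟯ K * ∏ σ ∈ s, σ x) := by
  classical
  have hx : IsIntegral ℚ x := Algebra.IsIntegral.isIntegral x
  have hx' : IsAlgebraic ℚ (σ₀ x) := (hx.map σ₀).isAlgebraic
  have hmin : minpoly ℚ (σ₀ x) = minpoly ℚ x := minpoly.algHom_eq σ₀ σ₀.injective x
  refine isIntegral_mul_prod_roots _ (fun σ : K →ₐ[ℚ] ℂ => σ x) (fun k => ?_) s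
  have h1 : C (((intMinpoly (σ₀ x)).leadingCoeff : ℂ) ^ finrank ℚ⟮x⟯ K) *
      ∏ σ : K →ₐ[ℚ] ℂ, (X - C (σ x)) =
      ((intMinpoly (σ₀ x)) ^ finrank ℚ⟮x⟯ K).map (Int.castRingHom ℂ) := by
    rw [prod_embeddings_eq_prod_roots_pow ℂ x (fun z => X - C z), C_pow, ← mul_pow,
      Polynomial.map_pow, (intMinpoly_map hx').1, hmin]
    congr 2
    have hs : ((minpoly ℚ x).map (algebraMap ℚ ℂ)).Splits := IsAlgClosed.splits _
    have := hs.eq_prod_roots_of_monic ((minpoly.monic hx).map _)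
    rw [aroots_def, ← this]
  rw [h1, coeff_map]
  exact isIntegral_algebraMap (R := ℤ) (A := ℂ)

open IntermediateField Module in
/-- A Liouville inequality for the values of integer polynomials at pairs of algebraic numbers. -/
theorem one_le_pow_mul_norm_eval {ι : Type*} [Fintype ι] {T : ℕ} (p : ι → ℤ) (e₁ e₂ : ι → ℕ)
    (he₁ : ∀ i, e₁ i ≤ T) (he₂ : ∀ i, e₂ i ≤ T) {L H : ℝ} (hL : 1 ≤ L)
    (hp : ∑ i, |(p i : ℝ)| ≤ L) (hH : 1 ≤ H) {α β : ℂ} (hα : IsAlgebraic ℚ α)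
    (hβ : IsAlgebraic ℚ β) {d : ℕ} (hd : finrank ℚ (adjoin ℚ ({α, β} : Set ℂ)) ≤ d)
    (hHα : algHeight α ≤ H) (hHβ : algHeight β ≤ H)
    (hne : ∑ i, (p i : ℂ) * α ^ e₁ i * β ^ e₂ i ≠ 0) :
    1 ≤ L ^ d * H ^ (2 * T * d) * ‖∑ i, (p i : ℂ) * α ^ e₁ i * β ^ e₂ i‖ := by
  classical
  have hfin : FiniteDimensional ℚ (adjoin ℚ ({α, β} : Set ℂ)) := by
    refine finiteDimensional_adjoin fun x hx => ?_
    rcases hx with rfl | rfl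
    · exact hα.isIntegral
    · exact hβ.isIntegral
  set K := adjoin ℚ ({α, β} : Set ℂ)
  let σ₀ : K →ₐ[ℚ] ℂ := K.val
  let x : K := ⟨α, subset_adjoin _ _ (by simp)⟩
  let y : K := ⟨β, subset_adjoin _ _ (by simp)⟩
  have hx : σ₀ x = α := rfl
  have hy : σ₀ y = β := rfl
  let z : K := ∑ i, (p i : K) * x ^ e₁ i * y ^ e₂ i
  have hσz : ∀ σ : K →ₐ[ℚ] ℂ, σ z = ∑ i, (p i : ℂ) * σ x ^ e₁ i * σ y ^ e₂ i := by
    intro σ; simp [z]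
  have hz : σ₀ z = ∑ i, (p i : ℂ) * α ^ e₁ i * β ^ e₂ i := by rw [hσz, hx, hy]
  rw [← hz] at hne ⊢
  have hz0 : z ≠ 0 := fun h => hne (by simp [h])
  set a : ℤ := (intMinpoly α).leadingCoeff ^ finrank ℚ⟮x⟯ K with ha
  set b : ℤ := (intMinpoly β).leadingCoeff ^ finrank ℚ⟮y⟯ K with hb
  have ha0 : a ≠ 0 := pow_ne_zero _ (intMinpoly_map hα).2.1
  have hb0 : b ≠ 0 := pow_ne_zero _ (intMinpoly_map hβ).2.1
  have hA : ∀ e : (K →ₐ[ℚ] ℂ) → ℕ, (∀ σ, e σ ≤ T) →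
      IsIntegral ℤ ((a : ℂ) ^ T * ∏ σ, σ x ^ e σ) := fun e he =>
    isIntegral_pow_mul_prod_pow _ (fun σ : K →ₐ[ℚ] ℂ => σ x) (fun s => by
      simpa [ha, hx] using isIntegral_leadingCoeff_mul_prod_embeddings σ₀ x s) T e he
  have hB : ∀ e : (K →ₐ[ℚ] ℂ) → ℕ, (∀ σ, e σ ≤ T) →
      IsIntegral ℤ ((b : ℂ) ^ T * ∏ σ, σ y ^ e σ) := fun e he =>
    isIntegral_pow_mul_prod_pow _ (fun σ : K →ₐ[ℚ] ℂ => σ y) (fun s => by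
      simpa [hb, hy] using isIntegral_leadingCoeff_mul_prod_embeddings σ₀ y s) T e he
  -- Expanding the product over `σ` yields monomials in the conjugates with all exponents at most
  -- `T`, so `a ^ T * b ^ T` clears every denominator. The norm of `z` times this factor is then a
  -- nonzero rational integer.
  have hint : IsIntegral ℤ ((a : ℂ) ^ T * (b : ℂ) ^ T * ∏ σ : K →ₐ[ℚ] ℂ, σ z) := by
    simp_rw [hσz]
    rw [Finset.prod_univ_sum, Finset.mul_sum]
    refine IsIntegral.sum _ fun φ _ => ?_
    have : (a : ℂ) ^ T * (b : ℂ) ^ T *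
        ∏ σ : K →ₐ[ℚ] ℂ, ((p (φ σ) : ℂ) * σ x ^ e₁ (φ σ) * σ y ^ e₂ (φ σ)) =
        (∏ σ, (p (φ σ) : ℂ)) * ((a : ℂ) ^ T * ∏ σ : K →ₐ[ℚ] ℂ, σ x ^ e₁ (φ σ)) *
          ((b : ℂ) ^ T * ∏ σ : K →ₐ[ℚ] ℂ, σ y ^ e₂ (φ σ)) := by
      simp only [Finset.prod_mul_distrib]; ring
    rw [this]
    exact ((IsIntegral.prod _ fun σ _ => isIntegral_algebraMap (R := ℤ)).mul
      (hA _ fun σ => he₁ _)).mul (hB _ fun σ => he₂ _)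
  have hnorm : ∏ σ : K →ₐ[ℚ] ℂ, σ z = algebraMap ℚ ℂ (Algebra.norm ℚ z) :=
    (Algebra.norm_eq_prod_embeddings ℚ ℂ z).symm
  have hcast : (a : ℂ) ^ T * (b : ℂ) ^ T * ∏ σ : K →ₐ[ℚ] ℂ, σ z =
      algebraMap ℚ ℂ ((a : ℚ) ^ T * (b : ℚ) ^ T * Algebra.norm ℚ z) := by
    rw [hnorm]; simp
  rw [hcast, isIntegral_algebraMap_iff (FaithfulSMul.algebraMap_injective ℚ ℂ),
    IsIntegrallyClosed.isIntegral_iff] at hint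
  obtain ⟨k, hk⟩ := hint
  have hk0 : k ≠ 0 := by
    rintro rfl
    have : (a : ℚ) ^ T * (b : ℚ) ^ T * Algebra.norm ℚ z ≠ 0 := by
      refine mul_ne_zero (mul_ne_zero (pow_ne_zero _ (by exact_mod_cast ha0))
        (pow_ne_zero _ (by exact_mod_cast hb0))) ?_
      rwa [Ne, Algebra.norm_eq_zero_iff]
    exact this (by rw [← hk]; simp)
  have h1 : (1 : ℝ) ≤ |(a : ℝ)| ^ T * |(b : ℝ)| ^ T * ∏ σ : K →ₐ[ℚ] ℂ, ‖σ z‖ := by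
    have h2 : ‖(a : ℂ) ^ T * (b : ℂ) ^ T * ∏ σ : K →ₐ[ℚ] ℂ, σ z‖ = |(k : ℝ)| := by
      rw [hcast, ← hk]; simp
    rw [norm_mul, norm_mul, norm_pow, norm_pow, norm_prod, Complex.norm_intCast,
      Complex.norm_intCast] at h2
    rw [h2]
    exact_mod_cast Int.one_le_abs hk0
  let U : (K →ₐ[ℚ] ℂ) → ℝ := fun σ => L * (max 1 ‖σ x‖) ^ T * (max 1 ‖σ y‖) ^ T
  have hU1 : ∀ σ, 1 ≤ U σ := fun σ => by
    refine one_le_mul_of_one_le_of_one_le (one_le_mul_of_one_le_of_one_le hL ?_) ?_ <;>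
    exact one_le_pow₀ (le_max_left _ _)
  have hU : ∀ σ : K →ₐ[ℚ] ℂ, ‖σ z‖ ≤ U σ := by
    intro σ
    rw [hσz]
    refine (norm_sum_le _ _).trans ?_
    have : U σ ≥ ∑ i, |(p i : ℝ)| * ((max 1 ‖σ x‖) ^ T * (max 1 ‖σ y‖) ^ T) := by
      rw [← Finset.sum_mul]; simp only [U]; rw [mul_assoc]; gcongr
    refine le_trans (Finset.sum_le_sum fun i _ => ?_) this
    rw [norm_mul, norm_mul, norm_pow, norm_pow, Complex.norm_intCast, mul_assoc]
    gcongr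
    · exact (pow_le_pow_left₀ (norm_nonneg _) (le_max_right _ _) _).trans
        (pow_le_pow_right₀ (le_max_left _ _) (he₁ i))
    · exact (pow_le_pow_left₀ (norm_nonneg _) (le_max_right _ _) _).trans
        (pow_le_pow_right₀ (le_max_left _ _) (he₂ i))
  -- Only the factor at `σ₀` is kept. The others are bounded by `U`, and the missing factor `U σ₀ ≥
  -- 1` is restored so that the full product gives the heights.
  have h3 : ∏ σ : K →ₐ[ℚ] ℂ, ‖σ z‖ ≤ ‖σ₀ z‖ * ∏ σ, U σ := by
    rw [← Finset.mul_prod_erase _ _ (Finset.mem_univ σ₀),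
      ← Finset.mul_prod_erase _ U (Finset.mem_univ σ₀)]
    refine mul_le_mul_of_nonneg_left ?_ (norm_nonneg _)
    refine le_trans (Finset.prod_le_prod (fun _ _ => norm_nonneg _) fun σ _ => hU σ) ?_
    exact le_mul_of_one_le_left (Finset.prod_nonneg fun σ _ => zero_le_one.trans (hU1 σ)) (hU1 _)
  have hcard : Fintype.card (K →ₐ[ℚ] ℂ) = finrank ℚ K := AlgHom.card ℚ K ℂ
  have h4 : |(a : ℝ)| ^ T * |(b : ℝ)| ^ T * ∏ σ, U σ =
      L ^ finrank ℚ K * (algHeight α ^ finrank ℚ K) ^ T * (algHeight β ^ finrank ℚ K) ^ T := by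
    have e1 := leadingCoeff_pow_mul_prod_max σ₀ x
    have e2 := leadingCoeff_pow_mul_prod_max σ₀ y
    rw [hx] at e1
    rw [hy] at e2
    rw [← e1, ← e2]
    simp only [U, Finset.prod_mul_distrib, Finset.prod_const, Finset.card_univ, hcard, ha, hb,
      Finset.prod_pow, Int.cast_pow, abs_pow]
    ring
  have hα0 : 0 ≤ algHeight α ^ finrank ℚ K := by
    have e1 := leadingCoeff_pow_mul_prod_max σ₀ x
    rw [hx] at e1; rw [← e1]; positivity
  have hβ0 : 0 ≤ algHeight β ^ finrank ℚ K := by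
    have e1 := leadingCoeff_pow_mul_prod_max σ₀ y
    rw [hy] at e1; rw [← e1]; positivity
  have hnn : ∀ γ : ℂ, 0 ≤ algHeight γ := fun γ => by
    refine Real.rpow_nonneg (mul_nonneg (abs_nonneg _) (Multiset.prod_nonneg ?_)) _
    intro a ha
    obtain ⟨z, -, rfl⟩ := Multiset.mem_map.1 ha
    positivity
  have h5 : L ^ finrank ℚ K * (algHeight α ^ finrank ℚ K) ^ T * (algHeight β ^ finrank ℚ K) ^ T ≤
      L ^ d * H ^ (2 * T * d) := by
    calc _ ≤ L ^ d * (H ^ d) ^ T * (H ^ d) ^ T := by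
          have t1 : L ^ finrank ℚ K ≤ L ^ d := pow_le_pow_right₀ hL hd
          have t2 : algHeight α ^ finrank ℚ K ≤ H ^ d :=
            (pow_le_pow_left₀ (hnn _) hHα _).trans (pow_le_pow_right₀ hH hd)
          have t3 : algHeight β ^ finrank ℚ K ≤ H ^ d :=
            (pow_le_pow_left₀ (hnn _) hHβ _).trans (pow_le_pow_right₀ hH hd)
          gcongr
      _ = _ := by rw [← pow_mul, mul_assoc, ← pow_add]; congr 2; ring
  calc (1 : ℝ) ≤ |(a : ℝ)| ^ T * |(b : ℝ)| ^ T * ∏ σ : K →ₐ[ℚ] ℂ, ‖σ z‖ := h1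
    _ ≤ |(a : ℝ)| ^ T * |(b : ℝ)| ^ T * (‖σ₀ z‖ * ∏ σ, U σ) := by gcongr
    _ = |(a : ℝ)| ^ T * |(b : ℝ)| ^ T * (∏ σ, U σ) * ‖σ₀ z‖ := by ring
    _ = L ^ finrank ℚ K * (algHeight α ^ finrank ℚ K) ^ T *
          (algHeight β ^ finrank ℚ K) ^ T * ‖σ₀ z‖ := by rw [h4]
    _ ≤ _ := by gcongr

/-! ### Small integer combinations and the auxiliary polynomial. -/

open Metric Filter Topology in
/-- Taylor expansion with remainder estimate on the disc of half the radius. -/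
theorem exists_taylor_coeff_bounded {g : ℂ → ℂ} {w : ℂ} {ρ : ℝ} (hρ : 0 < ρ)
    (hg : DifferentiableOn ℂ g (ball w ρ)) (hb : ∀ z ∈ ball w ρ, ‖g z‖ ≤ 1) :
    ∃ c : ℕ → ℂ, (∀ k, ‖c k‖ ≤ 1) ∧ ∀ z, ‖z - w‖ ≤ ρ / 2 → ∀ L,
      ‖g z - ∑ k ∈ Finset.range L, c k * ((z - w) / ρ) ^ k‖ ≤ 2 * (1 / 2) ^ L := by
  have hρ' : (ρ : ℂ) ≠ 0 := by exact_mod_cast hρ.ne'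
  let c : ℕ → ℂ := fun k => (k.factorial : ℂ)⁻¹ * iteratedDeriv k g w * (ρ : ℂ) ^ k
  have hc : ∀ k, ‖c k‖ ≤ 1 := by
    intro k
    -- Nothing is assumed on the boundary circle, so Cauchy's estimate is taken at radius `r < ρ`
    -- and passed to the limit.
    have h1 : ∀ᶠ r in 𝓝[<] ρ, ‖iteratedDeriv k g w‖ * r ^ k ≤ k.factorial := by
      filter_upwards [Ioo_mem_nhdsLT hρ] with r hr
      have h2 := Complex.norm_iteratedDeriv_le_of_forall_mem_sphere_norm_le (c := w) (f := g)
        (C := 1) k hr.1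
        (((hg.mono (closedBall_subset_ball hr.2))).diffContOnCl_ball subset_rfl)
        (fun z hz => hb z (sphere_subset_closedBall.trans (closedBall_subset_ball hr.2) hz))
      rwa [mul_one, le_div_iff₀ (pow_pos hr.1 _)] at h2
    have h3 : Tendsto (fun r : ℝ => ‖iteratedDeriv k g w‖ * r ^ k) (𝓝[<] ρ)
        (𝓝 (‖iteratedDeriv k g w‖ * ρ ^ k)) :=
      ((continuous_const.mul (continuous_pow k)).tendsto ρ).mono_left nhdsWithin_le_nhds
    have h4 := le_of_tendsto h3 h1
    simp only [c, norm_mul, norm_inv, norm_pow, Complex.norm_natCast, Complex.norm_real,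
      Real.norm_of_nonneg hρ.le]
    rw [mul_assoc, inv_mul_le_iff₀ (by positivity), mul_one]
    exact h4
  refine ⟨c, hc, fun z hz L => ?_⟩
  have hzb : z ∈ ball w ρ := by
    rw [mem_ball, dist_eq_norm]; linarith
  have hs : HasSum (fun k => c k * ((z - w) / ρ) ^ k) (g z) := by
    have := Complex.hasSum_taylorSeries_on_ball hg hzb
    refine this.congr_fun fun k => ?_
    simp only [c, smul_eq_mul, div_pow]
    field_simp
  have hq : ‖(z - w) / (ρ : ℂ)‖ ≤ 1 / 2 := by
    rw [norm_div, Complex.norm_real, Real.norm_of_nonneg hρ.le, div_le_iff₀ hρ]; linarith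
  have hbound : ∀ k, ‖c (k + L) * ((z - w) / ρ) ^ (k + L)‖ ≤ (1 / 2) ^ L * (1 / 2 : ℝ) ^ k := by
    intro k
    rw [norm_mul, norm_pow, ← pow_add, add_comm L k]
    calc _ ≤ 1 * (1 / 2 : ℝ) ^ (k + L) := by gcongr; exact hc _
      _ = _ := one_mul _
  have h5 : g z - ∑ k ∈ Finset.range L, c k * ((z - w) / ρ) ^ k =
      ∑' k, c (k + L) * ((z - w) / ρ) ^ (k + L) := by
    rw [← hs.tsum_eq, ← hs.summable.sum_add_tsum_nat_add L]; ring
  rw [h5]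
  refine (tsum_of_norm_bounded ((hasSum_geometric_two).mul_left ((1 / 2 : ℝ) ^ L)) hbound).trans ?_
  rw [mul_comm]

/-- Dirichlet's box principle: a nonzero integer vector of size at most `B` at which finitely many
given linear forms are small. -/
theorem exists_int_vector_small {ι : Type*} [Fintype ι] [Nonempty ι] {L B s : ℕ} (hB : 0 < B)
    (hs : 0 < s)
    (hcard : s ^ (2 * L) < B ^ Fintype.card ι) (c : ι → ℕ → ℂ) (hc : ∀ i k, ‖c i k‖ ≤ 1) :
    ∃ p : ι → ℤ, p ≠ 0 ∧ (∀ i, |p i| ≤ B) ∧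
      ∀ k < L, ‖∑ i, (p i : ℂ) * c i k‖ ≤ 4 * Fintype.card ι * B / s := by
  classical
  set N : ℝ := Fintype.card ι * B with hN
  have hN0 : 0 < N := by
    have : 0 < Fintype.card ι := Fintype.card_pos
    positivity
  have hs0 : (0 : ℝ) < s := by exact_mod_cast hs
  let v : (ι → ℕ) → ℕ → ℂ := fun q k => ∑ i, (q i : ℂ) * c i k
  -- The interval `(-N, N)` is cut into `s` equal pieces. Real and imaginary parts of `L` forms give
  -- `s ^ (2 * L)` boxes for `B ^ card ι` vectors, and the difference of two vectors in one box is
  -- the answer.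
  let cell : ℝ → ℕ := fun t => ⌊(t + N) * s / (2 * N)⌋₊
  have hv : ∀ q ∈ Fintype.piFinset (fun _ : ι => Finset.range B), ∀ k, ‖v q k‖ < N := by
    intro q hq k
    have hq' : ∀ i, q i < B := fun i => by simpa using Fintype.mem_piFinset.1 hq i
    calc ‖v q k‖ ≤ ∑ i, ‖(q i : ℂ) * c i k‖ := norm_sum_le _ _
      _ < ∑ _i : ι, (B : ℝ) := by
          refine Finset.sum_lt_sum_of_nonempty Finset.univ_nonempty fun i _ => ?_
          rw [norm_mul, Complex.norm_natCast]
          calc (q i : ℝ) * ‖c i k‖ ≤ q i * 1 := by gcongr; exact hc i k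
            _ < B := by rw [mul_one]; exact_mod_cast hq' i
      _ = N := by simp [hN]
  have hcell : ∀ t : ℝ, |t| < N → cell t < s := by
    intro t ht
    rw [abs_lt] at ht
    have h0 : 0 ≤ (t + N) * s / (2 * N) := by
      have : 0 ≤ t + N := by linarith
      positivity
    rw [Nat.floor_lt h0, div_lt_iff₀ (by positivity)]
    nlinarith
  have hcell_eq : ∀ t u : ℝ, |t| < N → |u| < N → cell t = cell u → |t - u| ≤ 2 * N / s := by
    intro t u ht hu h
    rw [abs_lt] at ht hu
    have h0 : 0 ≤ (t + N) * s / (2 * N) := by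
      have : 0 ≤ t + N := by linarith
      positivity
    have h1 : 0 ≤ (u + N) * s / (2 * N) := by
      have : 0 ≤ u + N := by linarith
      positivity
    have e1 := Nat.floor_le h0
    have e2 := Nat.lt_floor_add_one ((t + N) * s / (2 * N))
    have e3 := Nat.floor_le h1
    have e4 := Nat.lt_floor_add_one ((u + N) * s / (2 * N))
    simp only [cell] at h
    rw [h] at e1 e2
    have e5 : |(t + N) * s / (2 * N) - (u + N) * s / (2 * N)| ≤ 1 := by
      rw [abs_le]; constructor <;> linarith
    have e6 : (t + N) * s / (2 * N) - (u + N) * s / (2 * N) = (t - u) * (s / (2 * N)) := by ring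
    rw [e6, abs_mul, abs_of_pos (a := (s : ℝ) / (2 * N)) (by positivity)] at e5
    rw [le_div_iff₀ hs0]
    rw [← mul_div_assoc, div_le_one (by positivity)] at e5
    exact e5
  let φ : (ι → ℕ) → (Fin L → ℕ × ℕ) := fun q k => (cell (v q k).re, cell (v q k).im)
  obtain ⟨q, hq, q', hq', hne, heq⟩ := Finset.exists_ne_map_eq_of_card_lt_of_maps_to
    (s := Fintype.piFinset (fun _ : ι => Finset.range B))
    (t := Fintype.piFinset (fun _ : Fin L => Finset.range s ×ˢ Finset.range s)) (f := φ)
    (by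
      simp only [Fintype.card_piFinset, Finset.card_product, Finset.card_range, Finset.prod_const,
        Finset.card_univ, Fintype.card_fin]
      rw [← sq, ← pow_mul]; exact hcard)
    (by
      intro q hq
      rw [Finset.mem_coe, Fintype.mem_piFinset]
      intro k
      simp only [φ, Finset.mem_product, Finset.mem_range]
      exact ⟨hcell _ ((Complex.abs_re_le_norm _).trans_lt (hv q hq k)),
        hcell _ ((Complex.abs_im_le_norm _).trans_lt (hv q hq k))⟩)
  refine ⟨fun i => (q i : ℤ) - q' i, ?_, ?_, ?_⟩
  · intro h
    apply hne
    funext i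
    have := congrFun h i
    simp only [Pi.zero_apply] at this
    omega
  · intro i
    have h1 : q i < B := by simpa using Fintype.mem_piFinset.1 hq i
    have h2 : q' i < B := by simpa using Fintype.mem_piFinset.1 hq' i
    change |(q i : ℤ) - q' i| ≤ B
    rw [abs_le]; constructor <;> omega
  · intro k hk
    have h1 : ∑ i, (((q i : ℤ) - q' i : ℤ) : ℂ) * c i k = v q k - v q' k := by
      simp only [v, ← Finset.sum_sub_distrib]
      refine Finset.sum_congr rfl fun i _ => ?_
      push_cast; ring
    rw [h1]
    have h2 := congrFun heq ⟨k, hk⟩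
    simp only [φ, Prod.mk.injEq] at h2
    have h3 := hcell_eq _ _ ((Complex.abs_re_le_norm _).trans_lt (hv q hq k))
      ((Complex.abs_re_le_norm _).trans_lt (hv q' hq' k)) h2.1
    have h4 := hcell_eq _ _ ((Complex.abs_im_le_norm _).trans_lt (hv q hq k))
      ((Complex.abs_im_le_norm _).trans_lt (hv q' hq' k)) h2.2
    refine (Complex.norm_le_abs_re_add_abs_im _).trans ?_
    rw [Complex.sub_re, Complex.sub_im]
    refine (add_le_add h3 h4).trans (le_of_eq ?_)
    rw [hN]; ring

open Metric in
/-- An integer combination of bounded analytic functions that is small on a smaller disc. -/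
theorem exists_int_combination_small {ι : Type*} [Fintype ι] [Nonempty ι] {L B s : ℕ} (hB : 0 < B)
    (hs : 0 < s)
    (hcard : s ^ (2 * L) < B ^ Fintype.card ι) {w : ℂ} {ρ : ℝ} (hρ : 0 < ρ) (g : ι → ℂ → ℂ)
    (hg : ∀ i, DifferentiableOn ℂ (g i) (ball w ρ)) (hb : ∀ i, ∀ z ∈ ball w ρ, ‖g i z‖ ≤ 1) :
    ∃ p : ι → ℤ, p ≠ 0 ∧ (∀ i, |p i| ≤ B) ∧
      ∀ z, ‖z - w‖ ≤ ρ / 2 → ‖∑ i, (p i : ℂ) * g i z‖ ≤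
        8 * Fintype.card ι * B / s + 2 * Fintype.card ι * B / 2 ^ L := by
  choose c hc1 hc2 using fun i => exists_taylor_coeff_bounded hρ (hg i) (hb i)
  obtain ⟨p, hp0, hpB, hp⟩ := exists_int_vector_small hB hs hcard c hc1
  refine ⟨p, hp0, hpB, fun z hz => ?_⟩
  set u : ℂ := (z - w) / ρ
  have hq : ‖u‖ ≤ 1 / 2 := by
    rw [norm_div, Complex.norm_real, Real.norm_of_nonneg hρ.le, div_le_iff₀ hρ]; linarith
  -- The first `L` Taylor coefficients of the combination are small by the box principle; the tails
  -- are small because `‖u‖ ≤ 1 / 2`.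
  have hsplit : ∑ i, (p i : ℂ) * g i z =
      ∑ k ∈ Finset.range L, (∑ i, (p i : ℂ) * c i k) * u ^ k +
        ∑ i, (p i : ℂ) * (g i z - ∑ k ∈ Finset.range L, c i k * u ^ k) := by
    simp_rw [mul_sub, Finset.sum_sub_distrib, Finset.sum_mul, Finset.mul_sum]
    rw [Finset.sum_comm (s := Finset.range L)]
    simp_rw [mul_assoc]
    ring
  rw [hsplit]
  have hδ0 : (0 : ℝ) ≤ 4 * Fintype.card ι * B / s := by positivity
  refine (norm_add_le _ _).trans (add_le_add ?_ ?_)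
  · refine (norm_sum_le _ _).trans ?_
    calc ∑ k ∈ Finset.range L, ‖(∑ i, (p i : ℂ) * c i k) * u ^ k‖
        ≤ ∑ k ∈ Finset.range L, (4 * Fintype.card ι * B / s : ℝ) * (1 / 2) ^ k := by
          refine Finset.sum_le_sum fun k hk => ?_
          rw [norm_mul, norm_pow]
          gcongr
          exact hp k (Finset.mem_range.1 hk)
      _ ≤ (4 * Fintype.card ι * B / s : ℝ) * 2 := by
          rw [← Finset.mul_sum]
          gcongr
          exact sum_geometric_two_le L
      _ = _ := by ring
  · refine (norm_sum_le _ _).trans ?_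
    calc ∑ i, ‖(p i : ℂ) * (g i z - ∑ k ∈ Finset.range L, c i k * u ^ k)‖
        ≤ ∑ _i : ι, (B : ℝ) * (2 * (1 / 2) ^ L) := by
          refine Finset.sum_le_sum fun i _ => ?_
          rw [norm_mul, Complex.norm_intCast]
          gcongr
          · exact_mod_cast hpB i
          · exact hc2 i z hz L
      _ = _ := by
          simp only [Finset.sum_const, Finset.card_univ, nsmul_eq_mul, one_div, inv_pow]
          ring

open Metric IntermediateField Module in
/-- A nonzero integer polynomial `P` of controlled degree and size such that `P(z, f(z))` vanishes
at all algebraic points of bounded degree and height in a given disc. -/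
theorem exists_polynomial_vanishing {f : ℂ → ℂ} (hf : AnalyticOnNhd ℂ f (ball 0 1))
    (hf1 : ∀ z ∈ ball (0 : ℂ) 1, ‖f z‖ ≤ 1) {d h T : ℕ} (hd : 2 ≤ d) (hh : 1 ≤ h)
    (hT : T = 160 * d ^ 2 * h) {w : ℂ} {ρ : ℝ} (hρ : 0 < ρ) (hw : ball w ρ ⊆ ball 0 1) :
    ∃ p : Fin T × Fin T → ℤ, p ≠ 0 ∧ (∀ i, |p i| ≤ 2 ^ (5 * T * h)) ∧
      ∀ α : ℂ, ‖α - w‖ ≤ ρ / 2 → IsAlgebraic ℚ α → IsAlgebraic ℚ (f α) →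
        finrank ℚ (adjoin ℚ ({α, f α} : Set ℂ)) ≤ d →
        algHeight α ≤ 4 ^ h → algHeight (f α) ≤ 4 ^ h →
        ∑ i, (p i : ℂ) * α ^ (i.1 : ℕ) * f α ^ (i.2 : ℕ) = 0 := by
  have hT1 : 1 ≤ T := by rw [hT]; exact Nat.one_le_iff_ne_zero.2 (by positivity)
  have hTh : 1 ≤ T * h := Nat.one_le_iff_ne_zero.2 (by positivity)
  have hNe : NeZero T := ⟨by omega⟩
  -- With `s = B ^ κ` and `T ^ 2 = 2 * L * (4 * d)`, the box condition reads `B ^ (2 * L * κ) < B ^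
  -- (2 * L * (κ + 1))`.
  obtain ⟨κ, hκ⟩ : ∃ κ, κ + 1 = 4 * d := ⟨4 * d - 1, by omega⟩
  set L := 8 * d * (20 * d * h) ^ 2 with hL
  have hcardι : Fintype.card (Fin T × Fin T) = T ^ 2 := by simp [sq]
  have hTT : T ^ 2 = 2 * L * (4 * d) := by rw [hT, hL]; ring
  have hLpos : 0 < L := by rw [hL]; positivity
  have hcard : ((2 ^ (5 * T * h)) ^ κ) ^ (2 * L) < (2 ^ (5 * T * h)) ^
      Fintype.card (Fin T × Fin T) := by
    rw [← pow_mul, hcardι, hTT, ← hκ]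
    refine Nat.pow_lt_pow_right (Nat.one_lt_two_pow (by nlinarith)) ?_
    nlinarith
  obtain ⟨p, hp0, hpB, hp⟩ := exists_int_combination_small (B := 2 ^ (5 * T * h))
    (s := (2 ^ (5 * T * h)) ^ κ) (by positivity) (by positivity) hcard hρ
    (fun i : Fin T × Fin T => fun z => z ^ (i.1 : ℕ) * f z ^ (i.2 : ℕ))
    (fun i => by
      have := hf.differentiableOn.mono hw
      fun_prop)
    (fun i z hz => by
      have h1 := hf1 z (hw hz)
      have h2 : ‖z‖ ≤ 1 := by have := hw hz; rw [mem_ball_zero_iff] at this; exact this.le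
      rw [norm_mul, norm_pow, norm_pow]
      exact mul_le_one₀ (pow_le_one₀ (norm_nonneg _) h2) (by positivity)
        (pow_le_one₀ (norm_nonneg _) h1))
  refine ⟨p, hp0, fun i => by exact_mod_cast hpB i, fun α hα ha hb hdeg h1 h2 => ?_⟩
  by_contra hne
  have hsize : (Fintype.card (Fin T × Fin T) : ℝ) * (2 : ℝ) ^ (5 * T * h) ≤ 2 ^ (7 * (T * h)) := by
    rw [hcardι]
    have e1 : (T : ℝ) ≤ 2 ^ T := by exact_mod_cast Nat.lt_two_pow_self.le
    calc ((T ^ 2 : ℕ) : ℝ) * (2 : ℝ) ^ (5 * T * h) ≤ (2 ^ T) ^ 2 * 2 ^ (5 * T * h) := by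
          push_cast; gcongr
      _ = 2 ^ (T * 2 + 5 * T * h) := by rw [← pow_mul, ← pow_add]
      _ ≤ _ := pow_le_pow_right₀ (by norm_num) (by nlinarith)
  have hLio := one_le_pow_mul_norm_eval (T := T) p (fun i => (i.1 : ℕ)) (fun i => (i.2 : ℕ))
    (fun i => i.1.2.le) (fun i => i.2.2.le) (L := 2 ^ (7 * (T * h))) (H := 4 ^ h)
    (one_le_pow₀ (by norm_num))
    (by
      refine le_trans (Finset.sum_le_sum (g := fun _ => (2 : ℝ) ^ (5 * T * h)) fun i _ => ?_) ?_
      · exact_mod_cast hpB i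
      · simpa using hsize)
    (one_le_pow₀ (by norm_num)) ha hb hdeg h1 h2 hne
  have hsmall := hp α hα
  simp_rw [← mul_assoc] at hsmall
  set F := ∑ i, (p i : ℂ) * α ^ (i.1 : ℕ) * f α ^ (i.2 : ℕ)
  -- The Liouville loss is `2 ^ (11 * T * h * d)`. Both error terms carry a saving of about `2 ^
  -- (-20 * T * h * d)`, since `B ^ (4 * d) = 2 ^ (20 * T * h * d)` and `L = 20 * T * h * d`; the
  -- margin absorbs the remaining factors because `d ≥ 2`.
  have e0 : (2 ^ (7 * (T * h)) : ℝ) ^ d * (4 ^ h) ^ (2 * T * d) = 2 ^ (11 * (T * h) * d) := by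
    rw [show (4 : ℝ) = 2 ^ 2 by norm_num]
    simp only [← pow_mul, ← pow_add]
    congr 1; ring
  rw [e0] at hLio
  have e1 : (8 * Fintype.card (Fin T × Fin T) * ((2 ^ (5 * T * h) : ℕ) : ℝ) /
      (((2 ^ (5 * T * h)) ^ κ : ℕ) : ℝ)) * 2 ^ (11 * (T * h) * d) ≤ 1 / 4 := by
    rw [div_mul_eq_mul_div, div_le_div_iff₀ (by positivity) (by norm_num)]
    push_cast
    calc _ = (Fintype.card (Fin T × Fin T) * (2 : ℝ) ^ (5 * T * h)) * 2 ^ 5 *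
          2 ^ (11 * (T * h) * d) := by ring
      _ ≤ 2 ^ (7 * (T * h)) * 2 ^ 5 * 2 ^ (11 * (T * h) * d) := by gcongr
      _ = 2 ^ (7 * (T * h) + 5 + 11 * (T * h) * d) := by rw [pow_add, pow_add]
      _ ≤ 2 ^ (5 * T * h * κ) := by
          refine pow_le_pow_right₀ (by norm_num) ?_
          have : 5 * T * h * κ + 5 * (T * h) = 20 * (T * h) * d := by
            calc _ = 5 * (T * h) * (κ + 1) := by ring
              _ = _ := by rw [hκ]; ring
          nlinarith
      _ = 1 * ((2 : ℝ) ^ (5 * T * h)) ^ κ := by rw [one_mul, ← pow_mul]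
  have e2 : (2 * Fintype.card (Fin T × Fin T) * ((2 ^ (5 * T * h) : ℕ) : ℝ) / 2 ^ L) *
      2 ^ (11 * (T * h) * d) ≤ 1 / 4 := by
    rw [div_mul_eq_mul_div, div_le_div_iff₀ (by positivity) (by norm_num)]
    push_cast
    calc _ = (Fintype.card (Fin T × Fin T) * (2 : ℝ) ^ (5 * T * h)) * 2 ^ 3 *
          2 ^ (11 * (T * h) * d) := by ring
      _ ≤ 2 ^ (7 * (T * h)) * 2 ^ 3 * 2 ^ (11 * (T * h) * d) := by gcongr
      _ = 2 ^ (7 * (T * h) + 3 + 11 * (T * h) * d) := by rw [pow_add, pow_add]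
      _ ≤ 2 ^ L := by
          refine pow_le_pow_right₀ (by norm_num) ?_
          have x1 : T * h = 160 * (d * h) ^ 2 := by rw [hT]; ring
          have x2 : L = 3200 * (d * h) ^ 2 * d := by rw [hL]; ring
          have x3 : 1 ≤ (d * h) ^ 2 := Nat.one_le_iff_ne_zero.2 (by positivity)
          rw [x1, x2]
          nlinarith
      _ = 1 * (2 : ℝ) ^ L := (one_mul _).symm
  have e3 : (2 : ℝ) ^ (11 * (T * h) * d) * ‖F‖ ≤ 1 / 2 := by
    calc _ = ‖F‖ * 2 ^ (11 * (T * h) * d) := mul_comm _ _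
      _ ≤ _ := mul_le_mul_of_nonneg_right hsmall (by positivity)
      _ ≤ 1 / 4 + 1 / 4 := by rw [add_mul]; exact add_le_add e1 e2
      _ = _ := by norm_num
  linarith

/-- Nonzero algebraic values of bounded degree and height are not too small. -/
theorem one_le_height_pow_mul_norm {α β : ℂ} (hα : IsAlgebraic ℚ α) (hβ : IsAlgebraic ℚ β) {d : ℕ}
    (hd : Module.finrank ℚ (IntermediateField.adjoin ℚ ({α, β} : Set ℂ)) ≤ d) {H : ℝ} (hH : 1 ≤ H)
    (hHα : algHeight α ≤ H) (hHβ : algHeight β ≤ H) (h0 : β ≠ 0) : 1 ≤ H ^ (2 * d) * ‖β‖ := by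
  have := one_le_pow_mul_norm_eval (ι := Unit) (T := 1) (fun _ => 1) (fun _ => 0) (fun _ => 1)
    (by simp) (by simp) (L := 1) le_rfl (by simp) hH hα hβ hd hHα hHβ (by simpa using h0)
  simpa using this

/-! ### Blaschke factors and zero counting. -/

open Metric Filter Topology in
/-- Dividing a bounded analytic function on the unit disc by a Blaschke factor at one of its
zeros. -/
theorem exists_div_blaschke {G : ℂ → ℂ} (hG : DifferentiableOn ℂ G (ball 0 1)) {M : ℝ}
    (hM : ∀ z ∈ ball (0 : ℂ) 1, ‖G z‖ ≤ M) {a : ℂ} (ha : a ∈ ball (0 : ℂ) 1) (h0 : G a = 0) :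
    ∃ G₁ : ℂ → ℂ, DifferentiableOn ℂ G₁ (ball 0 1) ∧ (∀ z ∈ ball (0 : ℂ) 1, ‖G₁ z‖ ≤ M) ∧
      ∀ z, G z * (1 - (starRingEnd ℂ) a * z) = (z - a) * G₁ z := by
  have hds : DifferentiableOn ℂ (dslope G a) (ball 0 1) :=
    (Complex.differentiableOn_dslope (isOpen_ball.mem_nhds ha)).2 hG
  have hid : ∀ z, G z = (z - a) * dslope G a z := by
    intro z
    have := sub_smul_dslope G a z
    rw [h0, sub_zero, smul_eq_mul] at this
    exact this.symm
  have hd1 : DifferentiableOn ℂ (fun z => dslope G a z * (1 - (starRingEnd ℂ) a * z))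
      (ball 0 1) := by fun_prop
  refine ⟨fun z => dslope G a z * (1 - (starRingEnd ℂ) a * z), hd1, ?_, fun z => ?_⟩
  · have ha1 : ‖a‖ < 1 := by simpa using ha
    have hM0 : 0 ≤ M := (norm_nonneg _).trans (hM a ha)
    intro z hz
    rw [mem_ball_zero_iff] at hz
    -- The maximum principle on circles `r < 1` gives the bound `M` times this factor, which tends
    -- to `1`: on `‖y‖ = r`, `‖1 - conj a * y‖` exceeds `‖y - a‖` by at most `1 - r ^ 2`.
    have hlim : Tendsto (fun r : ℝ => M * ((1 + (1 - r ^ 2) / (r - ‖a‖)))) (𝓝[<] 1)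
        (𝓝 (M * (1 + (1 - 1 ^ 2) / (1 - ‖a‖)))) := by
      have : ContinuousAt (fun r : ℝ => M * ((1 + (1 - r ^ 2) / (r - ‖a‖)))) 1 := by
        have : (1 : ℝ) - ‖a‖ ≠ 0 := by linarith
        fun_prop (disch := assumption)
      exact this.tendsto.mono_left nhdsWithin_le_nhds
    rw [one_pow, sub_self, zero_div, add_zero, mul_one] at hlim
    refine ge_of_tendsto hlim ?_
    filter_upwards [Ioo_mem_nhdsLT (max_lt hz ha1)] with r hr
    have hzr : ‖z‖ < r := (le_max_left _ _).trans_lt hr.1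
    have har : ‖a‖ < r := (le_max_right _ _).trans_lt hr.1
    have hr0 : 0 < r := (norm_nonneg _).trans_lt hzr
    refine Complex.norm_le_of_forall_mem_frontier_norm_le (U := ball (0 : ℂ) r) isBounded_ball
      ((hd1.mono (closedBall_subset_ball hr.2)).diffContOnCl_ball subset_rfl) ?_
      (subset_closure (by simpa using hzr))
    intro y hy
    rw [frontier_ball _ hr0.ne', mem_sphere_zero_iff_norm] at hy
    have hya' : r - ‖a‖ ≤ ‖y - a‖ := by
      have := norm_sub_norm_le y a
      rwa [hy] at this
    have hGy : ‖G y‖ ≤ M := hM y (by rw [mem_ball_zero_iff, hy]; exact hr.2)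
    have hbl : ‖1 - (starRingEnd ℂ) a * y‖ ≤ ‖y - a‖ + (1 - r ^ 2) := by
      have h1 : (r : ℂ) ^ 2 = (starRingEnd ℂ) y * y := by
        rw [← Complex.normSq_eq_conj_mul_self, Complex.normSq_eq_norm_sq, hy]; norm_cast
      have h2 : 1 - (starRingEnd ℂ) a * y = (starRingEnd ℂ) (y - a) * y + ((1 - r ^ 2 : ℝ) : ℂ) := by
        push_cast
        rw [h1, map_sub]; ring
      rw [h2]
      refine (norm_add_le _ _).trans ?_
      have h3 : 0 ≤ 1 - r ^ 2 := by nlinarith [hr.2]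
      rw [norm_mul, RCLike.norm_conj, hy, Complex.norm_real, Real.norm_of_nonneg h3]
      nlinarith [norm_nonneg (y - a), hr.2]
    have h3 : 0 ≤ 1 - r ^ 2 := by nlinarith [hr.2]
    have hra : 0 < r - ‖a‖ := by linarith
    have hya : 0 < ‖y - a‖ := hra.trans_le hya'
    have hfac : ‖y - a‖ * ‖dslope G a y‖ ≤ M := by
      rw [← norm_mul, ← hid y]; exact hGy
    rw [norm_mul]
    calc ‖dslope G a y‖ * ‖1 - (starRingEnd ℂ) a * y‖
        ≤ ‖dslope G a y‖ * (‖y - a‖ + (1 - r ^ 2)) := by gcongr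
      _ = ‖y - a‖ * ‖dslope G a y‖ * (1 + (1 - r ^ 2) / ‖y - a‖) := by field_simp
      _ ≤ M * (1 + (1 - r ^ 2) / (r - ‖a‖)) := by gcongr
  · rw [hid z]; ring

-- Blaschke factors are divided out one zero at a time. As the points are distinct, the quotient
-- still vanishes at the remaining ones. The form without quotients avoids nonvanishing conditions.
open Metric in
theorem norm_mul_prod_le_of_zeros {G : ℂ → ℂ} (hG : DifferentiableOn ℂ G (ball 0 1)) {M : ℝ}
    (hM : ∀ z ∈ ball (0 : ℂ) 1, ‖G z‖ ≤ M) (Z : Finset ℂ) (hZ : ∀ a ∈ Z, a ∈ ball (0 : ℂ) 1)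
    (h0 : ∀ a ∈ Z, G a = 0) {x : ℂ} (hx : x ∈ ball (0 : ℂ) 1) :
    ‖G x‖ * ∏ a ∈ Z, ‖1 - (starRingEnd ℂ) a * x‖ ≤ M * ∏ a ∈ Z, ‖x - a‖ := by
  induction Z using Finset.induction_on generalizing G with
  | empty => simpa using hM x hx
  | insert a Z ha ih =>
    obtain ⟨G₁, hG₁, hM₁, hid⟩ := exists_div_blaschke hG hM (hZ a (by simp)) (h0 a (by simp))
    have h1 := ih hG₁ hM₁ (fun c hc => hZ c (by simp [hc])) (fun c hc => by
      have h2 := hid c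
      rw [h0 c (by simp [hc]), zero_mul] at h2
      refine (mul_eq_zero.1 h2.symm).resolve_left (sub_ne_zero.2 ?_)
      rintro rfl; exact ha hc)
    rw [Finset.prod_insert ha, Finset.prod_insert ha, ← mul_assoc, ← norm_mul, hid x, norm_mul]
    calc _ = ‖x - a‖ * (‖G₁ x‖ * ∏ a ∈ Z, ‖1 - (starRingEnd ℂ) a * x‖) := by ring
      _ ≤ ‖x - a‖ * (M * ∏ a ∈ Z, ‖x - a‖) := by gcongr
      _ = _ := by ring

/-- From `|1 - conj a * x|² - |x - a|² = (1 - |a|²)(1 - |x|²) ≥ 1/(qR)` and `|1 - conj a * x| ≤ 2`,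
the squared ratio is at most `1 - 1/(4qR) ≤ exp(-1/(4qR))`. -/
theorem norm_sub_le_norm_one_sub_mul_exp {x a : ℂ} {q R : ℝ} (hq : 1 ≤ q) (hR : 1 ≤ R)
    (hx : ‖x‖ ≤ 1 - 1 / q) (ha : ‖a‖ ≤ 1 - 1 / R) :
    ‖x - a‖ ≤ ‖1 - (starRingEnd ℂ) a * x‖ * Real.exp (-(1 / (8 * q * R))) := by
  have hq0 : 0 < 1 / q := by positivity
  have hR0 : 0 < 1 / R := by positivity
  have hx1 : 1 / q ≤ 1 - ‖x‖ ^ 2 := by nlinarith [norm_nonneg x]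
  have ha1 : 1 / R ≤ 1 - ‖a‖ ^ 2 := by nlinarith [norm_nonneg a]
  have hsq : ‖x - a‖ ^ 2 = ‖1 - (starRingEnd ℂ) a * x‖ ^ 2 - (1 - ‖a‖ ^ 2) * (1 - ‖x‖ ^ 2) := by
    simp only [← Complex.normSq_eq_norm_sq, Complex.normSq_apply]
    simp
    ring
  have hle2 : ‖1 - (starRingEnd ℂ) a * x‖ ^ 2 ≤ 4 := by
    have : ‖1 - (starRingEnd ℂ) a * x‖ ≤ 2 := by
      refine (norm_sub_le _ _).trans ?_
      rw [norm_mul, RCLike.norm_conj, norm_one]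
      nlinarith [norm_nonneg x, norm_nonneg a]
    nlinarith [norm_nonneg (1 - (starRingEnd ℂ) a * x)]
  have hprod : 1 / q * (1 / R) ≤ (1 - ‖a‖ ^ 2) * (1 - ‖x‖ ^ 2) := by
    rw [mul_comm]; gcongr; linarith
  have hexp : 1 - 1 / q * (1 / R) / 4 ≤ Real.exp (-(1 / (8 * q * R))) ^ 2 := by
    rw [← Real.exp_nat_mul]
    have := Real.add_one_le_exp (-(1 / q * (1 / R) / 4))
    have h2 : ((2 : ℕ) : ℝ) * -(1 / (8 * q * R)) = -(1 / q * (1 / R) / 4) := by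
      field_simp; norm_num
    rw [h2]; linarith
  refine (pow_le_pow_iff_left₀ (norm_nonneg _) (by positivity) two_ne_zero).1 ?_
  rw [mul_pow, hsq]
  have hw : 0 < 1 / q * (1 / R) := by positivity
  have hw0 : 0 ≤ ‖1 - (starRingEnd ℂ) a * x‖ ^ 2 := by positivity
  nlinarith

open Metric in
/-- A Jensen-type bound for the number of zeros of a bounded analytic function. -/
theorem card_zeros_le {G : ℂ → ℂ} (hG : DifferentiableOn ℂ G (ball 0 1)) {M : ℝ}
    (hM : ∀ z ∈ ball (0 : ℂ) 1, ‖G z‖ ≤ M) {q R : ℝ} (hq : 1 ≤ q) (hR : 1 ≤ R) {x : ℂ}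
    (hx : ‖x‖ ≤ 1 - 1 / q) {m : ℝ} (hm : 0 < m) (hGx : m ≤ ‖G x‖) (Z : Finset ℂ)
    (hZ : ∀ a ∈ Z, ‖a‖ ≤ 1 - 1 / R ∧ G a = 0) :
    (Z.card : ℝ) ≤ 8 * q * R * Real.log (M / m) := by
  have hq0 : 0 < 1 / q := by positivity
  have hR0 : 0 < 1 / R := by positivity
  have hxb : x ∈ ball (0 : ℂ) 1 := by rw [mem_ball_zero_iff]; linarith
  have hZb : ∀ a ∈ Z, a ∈ ball (0 : ℂ) 1 := fun a ha => by
    rw [mem_ball_zero_iff]; linarith [(hZ a ha).1]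
  have hM0 : 0 < M := hm.trans_le (hGx.trans (hM x hxb))
  have h1 := norm_mul_prod_le_of_zeros hG hM Z hZb (fun a ha => (hZ a ha).2) hxb
  set D := ∏ a ∈ Z, ‖1 - (starRingEnd ℂ) a * x‖
  have hD : 0 < D := by
    refine Finset.prod_pos fun a ha => norm_pos_iff.2 fun h => ?_
    have h2 : (1 : ℝ) = ‖a‖ * ‖x‖ := by
      rw [← RCLike.norm_conj a, ← norm_mul, ← sub_eq_zero.1 h, norm_one]
    have h3 := mem_ball_zero_iff.1 hxb
    have h4 := mem_ball_zero_iff.1 (hZb a ha)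
    nlinarith [norm_nonneg x, norm_nonneg a]
  have h2 : ∏ a ∈ Z, ‖x - a‖ ≤ D * Real.exp (-(1 / (8 * q * R))) ^ Z.card := by
    rw [← Finset.prod_const, ← Finset.prod_mul_distrib]
    exact Finset.prod_le_prod (fun _ _ => norm_nonneg _) fun a ha =>
      norm_sub_le_norm_one_sub_mul_exp hq hR hx (hZ a ha).1
  have h3 : m * D ≤ M * Real.exp (-(1 / (8 * q * R))) ^ Z.card * D := by
    calc m * D ≤ ‖G x‖ * D := by gcongr
      _ ≤ M * ∏ a ∈ Z, ‖x - a‖ := h1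
      _ ≤ M * (D * Real.exp (-(1 / (8 * q * R))) ^ Z.card) := by gcongr
      _ = _ := by ring
  have h4 := le_of_mul_le_mul_right h3 hD
  have h5 := Real.log_le_log hm h4
  rw [Real.log_mul hM0.ne' (by positivity), Real.log_pow, Real.log_exp] at h5
  rw [Real.log_div hM0.ne' hm.ne']
  have h6 : Z.card * (1 / (8 * q * R)) ≤ Real.log M - Real.log m := by linarith
  rw [mul_one_div, div_le_iff₀ (by positivity)] at h6
  linarith

/-! ### A lower bound for the auxiliary function near `1`. -/

open Metric Polynomial in
/-- Removing the largest power of `f` from `P(z, f(z))`. -/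
theorem exists_factor_without_power {f : ℂ → ℂ} (hf : DifferentiableOn ℂ f (ball 0 1))
    (hf1 : ∀ z ∈ ball (0 : ℂ) 1, ‖f z‖ ≤ 1) {T : ℕ} {B : ℝ} {p : Fin T × Fin T → ℤ} (hp : p ≠ 0)
    (hB : ∀ i, |(p i : ℝ)| ≤ B) :
    ∃ (G : ℂ → ℂ) (A : ℤ[X]), DifferentiableOn ℂ G (ball 0 1) ∧
      (∀ z ∈ ball (0 : ℂ) 1, ‖G z‖ ≤ T ^ 2 * B) ∧
      (∀ z, f z ≠ 0 → ∑ i, (p i : ℂ) * z ^ (i.1 : ℕ) * f z ^ (i.2 : ℕ) = 0 → G z = 0) ∧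
      A ≠ 0 ∧ A.natDegree < T ∧
      ∀ z ∈ ball (0 : ℂ) 1, ‖G z - A.aeval z‖ ≤ T ^ 2 * B * ‖f z‖ := by
  classical
  -- `j` is the least exponent of `f` occurring with a nonzero coefficient, and `A` collects the
  -- terms with that exponent.
  have hex : ∃ j : ℕ, ∃ i : Fin T × Fin T, (i.2 : ℕ) = j ∧ p i ≠ 0 := by
    obtain ⟨i, hi⟩ := Function.ne_iff.1 hp
    exact ⟨i.2, i, rfl, hi⟩
  set j := Nat.find hex with hj
  obtain ⟨i₀, hi₀, hpi₀⟩ := Nat.find_spec hex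
  rw [← hj] at hi₀
  have hmin : ∀ i, (i.2 : ℕ) < j → p i = 0 := fun i hi => by
    by_contra h
    exact Nat.find_min hex hi ⟨i, rfl, h⟩
  have hB0 : 0 ≤ B := (abs_nonneg _).trans (hB i₀)
  have hT : 0 < T := i₀.1.pos
  have hsum : ∀ C : ℝ, ∑ _i : Fin T × Fin T, C = T ^ 2 * C := by
    intro C; simp [sq]
  let A : ℤ[X] := ∑ i : Fin T, monomial (i : ℕ) (p (i, i₀.2))
  have hAc : A.coeff i₀.1 = p i₀ := by
    simp only [A, finsetSum_coeff, coeff_monomial]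
    rw [Finset.sum_eq_single i₀.1]
    · simp
    · intro b _ hb
      rw [if_neg]
      exact fun h => hb (Fin.ext h)
    · simp
  -- Truncation in `i.2 - j` is harmless: the coefficients with `i.2 < j` vanish.
  refine ⟨fun z => ∑ i, (p i : ℂ) * z ^ (i.1 : ℕ) * f z ^ ((i.2 : ℕ) - j), A, ?_, ?_, ?_, ?_, ?_, ?_⟩
  · fun_prop
  · intro z hz
    have h1 := hf1 z hz
    have h2 : ‖z‖ ≤ 1 := by rw [mem_ball_zero_iff] at hz; exact hz.le
    refine (norm_sum_le _ _).trans ?_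
    rw [← hsum]
    refine Finset.sum_le_sum fun i _ => ?_
    rw [norm_mul, norm_mul, norm_pow, norm_pow, Complex.norm_intCast, mul_assoc]
    calc _ ≤ B * (1 * 1) := by
          gcongr
          · exact hB i
          · exact pow_le_one₀ (norm_nonneg _) h2
          · exact pow_le_one₀ (norm_nonneg _) h1
      _ = B := by ring
  · intro z hz h
    have h1 : f z ^ j * ∑ i, (p i : ℂ) * z ^ (i.1 : ℕ) * f z ^ ((i.2 : ℕ) - j) = 0 := by
      rw [← h, Finset.mul_sum]
      refine Finset.sum_congr rfl fun i _ => ?_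
      rcases lt_or_ge (i.2 : ℕ) j with hi | hi
      · simp [hmin i hi]
      · conv_rhs => rw [← Nat.sub_add_cancel hi, pow_add]
        ring
    exact (mul_eq_zero.1 h1).resolve_left (pow_ne_zero _ hz)
  · intro h
    rw [h] at hAc
    exact hpi₀ (by simpa using hAc.symm)
  · refine (natDegree_sum_le _ _).trans_lt ?_
    rw [Finset.fold_max_lt]
    exact ⟨hT, fun i _ => (natDegree_monomial_le _).trans_lt i.2⟩
  · intro z hz
    have h1 := hf1 z hz
    have h2 : ‖z‖ ≤ 1 := by rw [mem_ball_zero_iff] at hz; exact hz.le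
    have hA : A.aeval z = ∑ i : Fin T × Fin T,
        if i.2 = i₀.2 then (p i : ℂ) * z ^ (i.1 : ℕ) else 0 := by
      rw [Fintype.sum_prod_type]
      simp [A, aeval_monomial]
    rw [hA, ← Finset.sum_sub_distrib]
    refine (norm_sum_le _ _).trans ?_
    rw [mul_assoc, ← hsum]
    refine Finset.sum_le_sum fun i _ => ?_
    split_ifs with hi
    · have : (i.2 : ℕ) - j = 0 := by rw [hi, hi₀]; simp
      rw [this, pow_zero, mul_one, sub_self, norm_zero]
      positivity
    · rcases lt_or_ge (i.2 : ℕ) j with hlt | hge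
      · rw [hmin i hlt]; simp only [Int.cast_zero, zero_mul, sub_zero, norm_zero]; positivity
      · have hne : (i.2 : ℕ) ≠ j := fun h => hi (Fin.ext (h.trans hi₀.symm))
        obtain ⟨k, hk⟩ : ∃ k, (i.2 : ℕ) - j = k + 1 := ⟨(i.2 : ℕ) - j - 1, by omega⟩
        rw [hk, sub_zero, norm_mul, norm_mul, norm_pow, norm_pow, Complex.norm_intCast, mul_assoc,
          pow_succ]
        calc _ ≤ B * (1 * (1 * ‖f z‖)) := by
              gcongr
              · exact hB i
              · exact pow_le_one₀ (norm_nonneg _) h2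
              · exact pow_le_one₀ (norm_nonneg _) h1
          _ = _ := by ring

open Polynomial in
/-- A nonzero integer polynomial of degree less than `T` is not too small at one of `T` given
rational points. -/
theorem exists_one_le_pow_mul_abs_eval {A : ℤ[X]} (hA : A ≠ 0) {T q₀ : ℕ} (hT : A.natDegree < T)
    (hq₀ : 1 ≤ q₀) : ∃ q : ℕ, q₀ ≤ q ∧ q < q₀ + T ∧
      1 ≤ (q : ℝ) ^ T * ‖A.aeval ((1 - 1 / q : ℝ) : ℂ)‖ := by
  classical
  set A' : ℝ[X] := A.map (algebraMap ℤ ℝ)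
  have hA' : A' ≠ 0 := (Polynomial.map_ne_zero_iff (FaithfulSMul.algebraMap_injective ℤ ℝ)).2 hA
  -- The `T` points `1 - 1/q` are distinct and the degree is less than `T`, so one of them is not a
  -- root. There the denominator `q` bounds the value from below.
  obtain ⟨q, hq, hroot⟩ : ∃ q ∈ Finset.Ico q₀ (q₀ + T), A'.eval (1 - 1 / (q : ℝ)) ≠ 0 := by
    by_contra! hall
    have hinj : Set.InjOn (fun q : ℕ => 1 - 1 / (q : ℝ)) (Finset.Ico q₀ (q₀ + T)) := by
      intro a ha b hb hab
      have h1 : 1 / (a : ℝ) = 1 / b := by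
        simp only at hab; linarith
      rw [one_div, one_div, inv_inj] at h1
      exact_mod_cast h1
    have h1 : (Finset.Ico q₀ (q₀ + T)).card ≤ A'.roots.toFinset.card := by
      rw [← Finset.card_image_of_injOn hinj]
      refine Finset.card_le_card fun y hy => ?_
      obtain ⟨q, hq, rfl⟩ := Finset.mem_image.1 hy
      rw [Multiset.mem_toFinset, mem_roots hA']
      exact hall q hq
    have h2 := h1.trans ((Multiset.toFinset_card_le _).trans (card_roots' A'))
    rw [Nat.card_Ico] at h2
    have h3 : A'.natDegree ≤ A.natDegree := natDegree_map_le
    omega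
  rw [Finset.mem_Ico] at hq
  refine ⟨q, hq.1, hq.2, ?_⟩
  have hq0 : (1 : ℝ) ≤ q := by exact_mod_cast hq₀.trans hq.1
  have he : (1 - 1 / (q : ℝ)) = (((q : ℤ) - 1 : ℤ) : ℝ) / ((q : ℤ) : ℝ) := by
    push_cast; field_simp
  rw [he] at hroot
  have h1 := one_le_pow_mul_abs_eval_div (K := ℝ) (f := A) (b := (q : ℤ))
    (by exact_mod_cast (zero_lt_one.trans_le (hq₀.trans hq.1))) hroot
  rw [← he] at h1
  have h2 : ‖A.aeval ((1 - 1 / q : ℝ) : ℂ)‖ = |A'.eval (1 - 1 / (q : ℝ))| := by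
    rw [← Complex.coe_algebraMap, aeval_algebraMap_apply, Complex.coe_algebraMap, Complex.norm_real,
      Real.norm_eq_abs, eval_map_algebraMap]
  rw [h2]
  refine h1.trans ?_
  gcongr
  push_cast
  exact pow_le_pow_right₀ hq0 hT.le

open Metric in
/-- The number of zeros of `P(z, f(z))` at which `f` does not vanish. -/
theorem card_zeros_polynomial_le {f : ℂ → ℂ} {S : Set ℂ} {a b : ℝ} (hb : 1 < b)
    (hf : DecaysOn f S a b) {T : ℕ} {B : ℝ} (hB1 : 1 ≤ B) {p : Fin T × Fin T → ℤ} (hp : p ≠ 0)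
    (hB : ∀ i, |(p i : ℝ)| ≤ B) {q₀ : ℕ} (hq₀ : 2 ≤ q₀) (hT : T ≤ q₀)
    (hq : ∀ q : ℕ, q₀ ≤ q → q ≤ 2 * q₀ → 2 * a * T ^ 2 * B * (q : ℝ) ^ T ≤ b ^ q)
    {R : ℝ} (hR : 1 ≤ R) (Z : Finset ℂ)
    (hZ : ∀ z ∈ Z, ‖z‖ ≤ 1 - 1 / R ∧ f z ≠ 0 ∧
      ∑ i, (p i : ℂ) * z ^ (i.1 : ℕ) * f z ^ (i.2 : ℕ) = 0) :
    (Z.card : ℝ) ≤ 16 * q₀ * R * Real.log (2 * T ^ 2 * B * (2 * q₀) ^ T) := by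
  obtain ⟨G, A, hG, hGM, hGz, hA, hAT, hGA⟩ :=
    exists_factor_without_power hf.analytic.differentiableOn hf.norm_le_one hp hB
  obtain ⟨q, hq1, hq2, hAq⟩ := exists_one_le_pow_mul_abs_eval hA (T := T) (q₀ := q₀) hAT (by omega)
  have hT1 : (1 : ℝ) ≤ T := by exact_mod_cast (by omega : 1 ≤ T)
  have hqr : (2 : ℝ) ≤ q := by exact_mod_cast hq₀.trans hq1
  have hq2' : (q : ℝ) ≤ 2 * q₀ := by exact_mod_cast (by omega : q ≤ 2 * q₀)
  have hinv : 1 / (q : ℝ) ≤ 1 / 2 := by gcongr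
  have hinv0 : 0 < 1 / (q : ℝ) := by positivity
  set x : ℝ := 1 - 1 / q
  have hx0 : 0 < x := by simp only [x]; linarith
  have hx1 : x < 1 := by simp only [x]; linarith
  have hnx : ‖(x : ℂ)‖ = x := by rw [Complex.norm_real, Real.norm_of_nonneg hx0.le]
  have hxb : (x : ℂ) ∈ ball (0 : ℂ) 1 := by rw [mem_ball_zero_iff, hnx]; exact hx1
  have hb0 : (0 : ℝ) < b := by linarith
  have hfx : ‖f x‖ * b ^ q ≤ a := by
    have h1 := hf.decay x (hf.interval_subset x hx0 hx1)
    have h2 : diskPhi (x : ℂ) = q := by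
      rw [diskPhi, hnx]; simp [x]
    rw [h2, Real.rpow_neg hb0.le, Real.rpow_natCast] at h1
    rw [← div_eq_mul_inv, le_div_iff₀ (by positivity)] at h1
    exact h1
  have hqT : (0 : ℝ) < (q : ℝ) ^ T := by positivity
  -- The hypothesis on `q₀` is tailored to this: since `diskPhi x = q`, the contribution of `f` is
  -- at most half the lower bound `1 / q ^ T` for `A`. The range up to `2 * q₀` suffices because `q
  -- < q₀ + T` and `T ≤ q₀`.
  have hsmall : T ^ 2 * B * ‖f x‖ ≤ 1 / (2 * (q : ℝ) ^ T) := by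
    have h1 := hq q hq1 (by omega)
    rw [le_div_iff₀ (by positivity)]
    have h2 : (0 : ℝ) < b ^ q := by positivity
    refine le_of_mul_le_mul_right ?_ h2
    calc T ^ 2 * B * ‖f x‖ * (2 * (q : ℝ) ^ T) * b ^ q
        = 2 * (‖f x‖ * b ^ q) * T ^ 2 * B * (q : ℝ) ^ T := by ring
      _ ≤ 2 * a * T ^ 2 * B * (q : ℝ) ^ T := by gcongr
      _ ≤ 1 * b ^ q := by rw [one_mul]; exact h1
  have hlow : 1 / (2 * (q : ℝ) ^ T) ≤ ‖G x‖ := by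
    have h1 := hGA x hxb
    have h2 : 1 / (q : ℝ) ^ T ≤ ‖A.aeval (x : ℂ)‖ := by
      rw [div_le_iff₀ hqT, mul_comm]; exact hAq
    have h3 := norm_sub_norm_le (A.aeval (x : ℂ)) (G x)
    rw [norm_sub_rev] at h3
    have h4 : 1 / (2 * (q : ℝ) ^ T) + 1 / (2 * (q : ℝ) ^ T) = 1 / (q : ℝ) ^ T := by
      field_simp; norm_num
    linarith
  have hfin := card_zeros_le hG hGM (q := q) (R := R) (by linarith) hR (x := x) hnx.le
    (by positivity) hlow Z (fun z hz => ⟨(hZ z hz).1, hGz z (hZ z hz).2.1 (hZ z hz).2.2⟩)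
  refine hfin.trans ?_
  have hle : T ^ 2 * B / (1 / (2 * (q : ℝ) ^ T)) ≤ 2 * T ^ 2 * B * (2 * q₀) ^ T := by
    rw [div_div_eq_mul_div, div_one]
    calc T ^ 2 * B * (2 * (q : ℝ) ^ T) = 2 * T ^ 2 * B * (q : ℝ) ^ T := by ring
      _ ≤ _ := by gcongr
  have hlog : 0 ≤ Real.log (2 * T ^ 2 * B * (2 * q₀) ^ T) := by
    refine Real.log_nonneg ?_
    have h1 : (1 : ℝ) ≤ (2 * q₀) ^ T := one_le_pow₀ (by linarith)
    have h2 : (1 : ℝ) ≤ T ^ 2 := one_le_pow₀ hT1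
    calc (1 : ℝ) = 1 * 1 * 1 * 1 := by norm_num
      _ ≤ 2 * T ^ 2 * B * (2 * q₀) ^ T := by gcongr; norm_num
  calc 8 * (q : ℝ) * R * Real.log (T ^ 2 * B / (1 / (2 * (q : ℝ) ^ T)))
      ≤ 8 * q * R * Real.log (2 * T ^ 2 * B * (2 * q₀) ^ T) := by
        gcongr
    _ ≤ 8 * (2 * q₀) * R * Real.log (2 * T ^ 2 * B * (2 * q₀) ^ T) := by gcongr
    _ = _ := by ring

/-! ### Choice of parameters. -/

/-- The two normalizations of `a` amount to `l ≥ e` and `log a ≥ 1`; they let additive constants be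
absorbed into `l`, `log l` and `log a`. -/
theorem logRatio_estimates {a b : ℝ} (hb : 1 < b) (hab : b ^ Real.exp 1 ≤ a)
    (ha : Real.exp 1 ≤ a) :
    Real.exp 1 ≤ logRatio a b ∧ 1 ≤ Real.log (logRatio a b) ∧ 1 ≤ logRatio a b * Real.log b ∧
      logRatio a b * Real.log b = Real.log a := by
  have hlb : 0 < Real.log b := Real.log_pos hb
  have ha0 : 0 < a := (Real.exp_pos 1).trans_le ha
  have h1 : logRatio a b * Real.log b = Real.log a := div_mul_cancel₀ _ hlb.ne'
  have h2 : 1 ≤ Real.log a := by rwa [Real.le_log_iff_exp_le ha0]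
  have h3 : Real.exp 1 ≤ logRatio a b := by
    rw [logRatio, le_div_iff₀ hlb, ← Real.log_rpow (by linarith)]
    exact Real.log_le_log (Real.rpow_pos_of_pos (by linarith) _) hab
  refine ⟨h3, ?_, h1 ▸ h2, h1⟩
  rwa [Real.le_log_iff_exp_le ((Real.exp_pos 1).trans_le h3)]

theorem two_mul_sq_mul_two_pow_le {T h : ℕ} (hT : 1 ≤ T) (hh : 1 ≤ h) :
    (2 : ℝ) * T ^ 2 * 2 ^ (5 * T * h) ≤ 2 ^ (8 * (T * h)) := by
  have e1 : (T : ℝ) ≤ 2 ^ T := by exact_mod_cast Nat.lt_two_pow_self.le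
  have e2 : T ≤ T * h := Nat.le_mul_of_pos_right T hh
  calc (2 : ℝ) * T ^ 2 * 2 ^ (5 * T * h) ≤ 2 * (2 ^ T) ^ 2 * 2 ^ (5 * T * h) :=
        mul_le_mul_of_nonneg_right (mul_le_mul_of_nonneg_left
          (pow_le_pow_left₀ (by positivity) e1 2) (by norm_num)) (by positivity)
    _ = 2 ^ (1 + T * 2 + 5 * T * h) := by rw [← pow_mul, pow_add, pow_add, pow_one]
    _ ≤ _ := pow_le_pow_right₀ (by norm_num) (by rw [mul_assoc 5]; omega)

set_option maxHeartbeats 1000000 in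
/-- The choice of the point `1 - 1 / q₀` at which the auxiliary function is bounded below. -/
theorem exists_admissible_exponent {a b : ℝ} (hb : 1 < b) (hab : b ^ Real.exp 1 ≤ a)
    (ha : Real.exp 1 ≤ a) {d h T : ℕ} (hd : 2 ≤ d) (hh : 1 ≤ h) (hT : T = 160 * d ^ 2 * h) :
    ∃ q₀ : ℕ, 2 ≤ q₀ ∧ T ≤ q₀ ∧
      (∀ q : ℕ, q₀ ≤ q → q ≤ 2 * q₀ → 2 * a * T ^ 2 * 2 ^ (5 * T * h) * (q : ℝ) ^ T ≤ b ^ q) ∧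
      16 * q₀ * Real.log (2 * T ^ 2 * 2 ^ (5 * T * h) * (2 * q₀) ^ T) ≤
        80000 * logRatio a b * T ^ 2 * (h * Real.log (logRatio a b) * Real.log d) ^ 2 := by
  obtain ⟨hle, hll, hlb1, hla⟩ := logRatio_estimates hb hab ha
  set l := logRatio a b
  set lg := Real.log l
  set ld := Real.log (d : ℝ) with hld_def
  -- A product that dominates each of `h`, `log l`, `log d` up to a constant: the first two factors
  -- are at least `1`, and `log d ≥ 2 / 3` accounts for the `3 / 2` below.
  set W : ℝ := h * lg * ld with hW
  have hlb : 0 < Real.log b := Real.log_pos hb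
  have ha0 : 0 < a := (Real.exp_pos 1).trans_le ha
  have he2 : (2 : ℝ) ≤ Real.exp 1 := by linarith [Real.add_one_le_exp (1 : ℝ)]
  have hl2 : 2 ≤ l := he2.trans hle
  have hl0 : 0 < l := by linarith
  have hhr : (1 : ℝ) ≤ h := by exact_mod_cast hh
  have hdr : (2 : ℝ) ≤ d := by exact_mod_cast hd
  have hld : 2 / 3 ≤ ld := by
    have h1 : Real.log 2 ≤ ld := Real.log_le_log (by norm_num) hdr
    linarith [Real.log_two_gt_d9]
  have hT1 : 1 ≤ T := by rw [hT]; exact Nat.one_le_iff_ne_zero.2 (by positivity)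
  have hTr : (1 : ℝ) ≤ T := by exact_mod_cast hT1
  have hT160 : (160 : ℝ) ≤ T := by
    have : 160 ≤ T := by
      rw [hT]
      calc 160 = 160 * 1 * 1 := rfl
        _ ≤ 160 * d ^ 2 * h := by gcongr; exact Nat.one_le_pow _ _ (by omega)
    exact_mod_cast this
  have hhlg : (1 : ℝ) ≤ h * lg := by nlinarith
  have hWld : ld ≤ W := by rw [hW]; nlinarith
  have hWh : (h : ℝ) ≤ 3 / 2 * W := by
    have : (h : ℝ) * 1 * (2 / 3) ≤ h * lg * ld := by gcongr
    rw [hW]; linarith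
  have hWlg : lg ≤ 3 / 2 * W := by
    have : 1 * lg * (2 / 3) ≤ h * lg * ld := by gcongr
    rw [hW]; linarith
  have hW1 : 1 ≤ 3 / 2 * W := hhr.trans hWh
  have hW0 : 0 < W := by linarith
  -- The requirement is `q₀ * log b ≥ log a + Y`. As `log a = l * log b ≥ 1`, the right side is at
  -- most `l * (1 + Y) * log b`, and `1 + Y ≤ 50 * T * W`.
  set X : ℝ := 50 * l * T * W with hX
  have hlW : 1 ≤ l * W := by nlinarith
  have hXT : 50 * (T : ℝ) ≤ X := by
    have h1 : X = 50 * T * (l * W) := by rw [hX]; ring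
    rw [h1]
    nlinarith
  have hX1 : 1 ≤ X := by linarith
  set q₀ := ⌈X⌉₊ with hq₀
  have hXq : X ≤ q₀ := Nat.le_ceil X
  have hqX : (q₀ : ℝ) ≤ 2 * X := by
    have := Nat.ceil_lt_add_one (zero_le_one.trans hX1)
    linarith
  have hq0pos : (0 : ℝ) < q₀ := by linarith
  -- `q₀` enters `Y` only through its logarithm, which is a sum of terms of size `O(W)`; so defining
  -- `q₀` from a bound for `Y` is not circular.
  have hlogq : Real.log (2 * q₀) ≤ 25 * W := by
    have h1 : Real.log (2 * q₀) ≤ Real.log (2 ^ 15 * l * (d ^ 2 * h) * W) := by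
      refine Real.log_le_log (by positivity) ?_
      calc (2 : ℝ) * q₀ ≤ 2 * (2 * X) := by gcongr
        _ = 32000 * l * (d ^ 2 * h) * W := by rw [hX, hT]; push_cast; ring
        _ ≤ _ := by gcongr; norm_num
    have h2 : Real.log (2 ^ 15 * l * (d ^ 2 * h) * W) =
        15 * Real.log 2 + lg + (2 * ld + Real.log h) + Real.log W := by
      rw [Real.log_mul (by positivity) (by positivity), Real.log_mul (by positivity) (by positivity),
        Real.log_mul (by positivity) (by positivity), Real.log_mul (by positivity) (by positivity),
        Real.log_pow, Real.log_pow]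
      norm_num [lg, ld]
    have h3 : Real.log h ≤ h := (Real.log_le_sub_one_of_pos (by linarith)).trans (by linarith)
    have h4 : Real.log W ≤ W := (Real.log_le_sub_one_of_pos hW0).trans (by linarith)
    rw [h2] at h1
    linarith [Real.log_two_lt_d9]
  set Y := Real.log (2 * T ^ 2 * 2 ^ (5 * T * h) * (2 * q₀) ^ T) with hY
  have hYle : Y ≤ 8 * (T * h) + T * Real.log (2 * q₀) := by
    rw [hY, Real.log_mul (by positivity) (by positivity), Real.log_pow]
    gcongr
    have h1 := two_mul_sq_mul_two_pow_le hT1 hh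
    refine (Real.log_le_log (by positivity) h1).trans ?_
    rw [Real.log_pow]
    push_cast
    have h2 : (0 : ℝ) ≤ 8 * (T * h) := by positivity
    nlinarith [Real.log_two_lt_d9]
  have hYW : 1 + Y ≤ 50 * (T * W) := by
    have h1 : (T : ℝ) * Real.log (2 * q₀) ≤ T * (25 * W) := by gcongr
    have h2 : (T : ℝ) * h ≤ T * (3 / 2 * W) := by gcongr
    have h3 : (1 : ℝ) ≤ T * (3 / 2 * W) := by nlinarith
    linarith
  have hY0 : 0 ≤ Y := by
    refine Real.log_nonneg ?_
    have h1 : (1 : ℝ) ≤ (2 * q₀) ^ T := one_le_pow₀ (by linarith)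
    have h2 : (1 : ℝ) ≤ T ^ 2 := one_le_pow₀ hTr
    have h3 : (1 : ℝ) ≤ 2 ^ (5 * T * h) := one_le_pow₀ (by norm_num)
    calc (1 : ℝ) = 1 * 1 * 1 * 1 := by norm_num
      _ ≤ _ := by gcongr; norm_num
  have hkey : Real.log a + Y ≤ q₀ * Real.log b := by
    calc Real.log a + Y ≤ l * Real.log b + l * Real.log b * Y := by
          rw [hla]; rw [hla] at hlb1; nlinarith
      _ = l * (1 + Y) * Real.log b := by ring
      _ ≤ l * (50 * (T * W)) * Real.log b := by gcongr
      _ = X * Real.log b := by rw [hX]; ring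
      _ ≤ _ := by gcongr
  have hTq : (T : ℝ) ≤ q₀ := by linarith
  refine ⟨q₀, ?_, by exact_mod_cast hTq, ?_, ?_⟩
  · have : (2 : ℝ) ≤ q₀ := by linarith
    exact_mod_cast this
  · intro q hq1 hq2
    have hq1' : (q₀ : ℝ) ≤ q := by exact_mod_cast hq1
    have hq2' : (q : ℝ) ≤ 2 * q₀ := by exact_mod_cast hq2
    have hq0 : (0 : ℝ) < q := by linarith
    rw [← Real.log_le_log_iff (by positivity) (by positivity), Real.log_pow]
    calc Real.log (2 * a * T ^ 2 * 2 ^ (5 * T * h) * (q : ℝ) ^ T)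
        ≤ Real.log (a * (2 * T ^ 2 * 2 ^ (5 * T * h) * (2 * q₀) ^ T)) := by
          refine Real.log_le_log (by positivity) ?_
          calc 2 * a * T ^ 2 * 2 ^ (5 * T * h) * (q : ℝ) ^ T
              = a * (2 * T ^ 2 * 2 ^ (5 * T * h) * (q : ℝ) ^ T) := by ring
            _ ≤ _ := by gcongr
      _ = Real.log a + Y := by
          rw [Real.log_mul ha0.ne' (by positivity)]
      _ ≤ q₀ * Real.log b := hkey
      _ ≤ _ := by gcongr
  · calc 16 * q₀ * Y ≤ 16 * (2 * X) * (50 * (T * W)) := by gcongr; linarith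
      _ = _ := by rw [hX]; ring

/-! ### Counting the algebraic points. -/

/-- The bound for the algebraic points in a small disc. -/
theorem card_algPoints_small_disc_le {f : ℂ → ℂ} {S : Set ℂ} {a b : ℝ} (hb : 1 < b)
    (hab : b ^ Real.exp 1 ≤ a) (ha : Real.exp 1 ≤ a) (hf : DecaysOn f S a b) {d h : ℕ}
    (hd : 2 ≤ d) (hh : 1 ≤ h) {R : ℝ} (hR : 1 ≤ R) {w : ℂ} (hw : ‖w‖ ≤ 1 - 1 / R) (Z : Finset ℂ)
    (hZ : ∀ z ∈ Z, z ∈ algPoints f S d (4 ^ h) ∧ ‖z‖ ≤ 1 - 1 / R ∧ ‖z - w‖ ≤ 1 / (4 * R)) :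
    (Z.card : ℝ) ≤ 80000 * 160 ^ 2 * R * logRatio a b * d ^ 4 * h ^ 2 *
      (h * Real.log (logRatio a b) * Real.log d) ^ 2 := by
  obtain ⟨T, hT⟩ : ∃ T, T = 160 * d ^ 2 * h := ⟨_, rfl⟩
  obtain ⟨q₀, h1, h2, h3, h4⟩ := exists_admissible_exponent hb hab ha hd hh hT
  have hR0 : 0 < 1 / R := by positivity
  -- Radius `1 / (2 * R)` stays inside the unit disc, and the auxiliary polynomial controls half of
  -- it, hence the `1 / (4 * R)` in the hypothesis.
  have hball : Metric.ball w (1 / (2 * R)) ⊆ Metric.ball 0 1 := by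
    intro z hz
    rw [mem_ball_iff_norm] at hz
    rw [mem_ball_zero_iff]
    have e1 := norm_le_norm_add_norm_sub' z w
    have e2 : 1 / (2 * R) = 1 / R / 2 := by field_simp
    linarith
  obtain ⟨p, hp0, hpB, hp⟩ := exists_polynomial_vanishing hf.analytic hf.norm_le_one hd hh hT
    (ρ := 1 / (2 * R)) (by positivity) hball
  have h5 := card_zeros_polynomial_le hb hf (B := 2 ^ (5 * T * h)) (one_le_pow₀ (by norm_num)) hp0
    (fun i => by exact_mod_cast hpB i) h1 h2 h3 hR Z (fun z hz => by
      obtain ⟨⟨-, c1, c2, c3, c4, c5, c6⟩, c7, c8⟩ := hZ z hz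
      exact ⟨c7, c3, hp z (c8.trans_eq (by field_simp; norm_num)) c1 c2 c4 c5 c6⟩)
  calc (Z.card : ℝ) ≤ R * (16 * q₀ * Real.log (2 * T ^ 2 * 2 ^ (5 * T * h) * (2 * q₀) ^ T)) := by
        refine h5.trans_eq ?_; ring
    _ ≤ R * (80000 * logRatio a b * T ^ 2 *
          (h * Real.log (logRatio a b) * Real.log d) ^ 2) := by gcongr
    _ = _ := by rw [hT]; push_cast; ring

theorem norm_sub_le_of_floor_eq {z w : ℂ} {s : ℝ} (hs : 0 < s) (hre : ⌊z.re * s⌋ = ⌊w.re * s⌋)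
    (him : ⌊z.im * s⌋ = ⌊w.im * s⌋) : ‖z - w‖ ≤ 2 / s := by
  have h1 := Int.abs_sub_lt_one_of_floor_eq_floor hre
  have h2 := Int.abs_sub_lt_one_of_floor_eq_floor him
  rw [← sub_mul, abs_mul, abs_of_pos hs] at h1 h2
  refine (Complex.norm_le_abs_re_add_abs_im _).trans ?_
  rw [Complex.sub_re, Complex.sub_im, le_div_iff₀ hs]
  linarith

/-- A grid of mesh `1 / (8 * R)`: points in one cell are within `1 / (4 * R)`, so any counted point
of the cell serves as centre of a small disc. At most `(16 * R + 1) ^ 2 ≤ (17 * R) ^ 2` cells occur,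
and `80000 * 160 ^ 2 * 17 ^ 2 < 6 * 10 ^ 11`. -/
theorem card_algPoints_finset_le {f : ℂ → ℂ} {S : Set ℂ} {a b : ℝ} (hb : 1 < b)
    (hab : b ^ Real.exp 1 ≤ a) (ha : Real.exp 1 ≤ a) (hf : DecaysOn f S a b) {d h R : ℕ}
    (hd : 2 ≤ d) (hh : 1 ≤ h) (hR : 1 ≤ R) (Z : Finset ℂ)
    (hZ : ∀ z ∈ Z, z ∈ algPoints f S d (4 ^ h) ∧ ‖z‖ ≤ 1 - 1 / R) :
    (Z.card : ℝ) ≤ 6 * 10 ^ 11 * R ^ 3 * logRatio a b * d ^ 4 * h ^ 2 *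
      (h * Real.log (logRatio a b) * Real.log d) ^ 2 := by
  classical
  obtain ⟨hle, -, -, -⟩ := logRatio_estimates hb hab ha
  have hl0 : 0 < logRatio a b := (Real.exp_pos 1).trans_le hle
  have hRr : (1 : ℝ) ≤ R := by exact_mod_cast hR
  set K : ℝ := 80000 * 160 ^ 2 * R * logRatio a b * d ^ 4 * h ^ 2 *
      (h * Real.log (logRatio a b) * Real.log d) ^ 2 with hK
  have hK0 : 0 ≤ K := by positivity
  let cell : ℂ → ℤ × ℤ := fun z => (⌊z.re * (8 * R)⌋, ⌊z.im * (8 * R)⌋)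
  let t : Finset (ℤ × ℤ) := Finset.Icc (-(8 * R : ℤ)) (8 * R) ×ˢ Finset.Icc (-(8 * R : ℤ)) (8 * R)
  have hfl : ∀ u : ℝ, |u| ≤ 1 → ⌊u * (8 * R)⌋ ∈ Finset.Icc (-(8 * R : ℤ)) (8 * R) := by
    intro u hu
    rw [abs_le] at hu
    rw [Finset.mem_Icc]
    constructor
    · rw [Int.le_floor]; push_cast; nlinarith
    · have h1 : u * (8 * R) ≤ ((8 * R : ℤ) : ℝ) := by push_cast; nlinarith
      exact_mod_cast (Int.floor_le _).trans h1
  have hmaps : ∀ z ∈ Z, cell z ∈ t := by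
    intro z hz
    have h1 : ‖z‖ ≤ 1 := (hZ z hz).2.trans (by
      have : 0 < 1 / (R : ℝ) := by positivity
      linarith)
    exact Finset.mem_product.2 ⟨hfl _ ((Complex.abs_re_le_norm z).trans h1),
      hfl _ ((Complex.abs_im_le_norm z).trans h1)⟩
  have hfib : ∀ c ∈ t, (Z.filter fun z => cell z = c).card ≤ ⌊K⌋₊ := by
    intro c _
    rw [Nat.le_floor_iff hK0]
    rcases (Z.filter fun z => cell z = c).eq_empty_or_nonempty with h0 | ⟨w, hw⟩
    · rw [h0]; simpa using hK0
    · rw [Finset.mem_filter] at hw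
      refine card_algPoints_small_disc_le hb hab ha hf hd hh hRr (hZ w hw.1).2 _ fun z hz => ?_
      rw [Finset.mem_filter] at hz
      refine ⟨(hZ z hz.1).1, (hZ z hz.1).2, ?_⟩
      have h1 : cell z = cell w := hz.2.trans hw.2.symm
      simp only [cell, Prod.mk.injEq] at h1
      refine (norm_sub_le_of_floor_eq (s := 8 * R) (by positivity) h1.1 h1.2).trans_eq ?_
      field_simp; norm_num
  have h1 := Finset.card_le_mul_card_image_of_maps_to hmaps _ hfib
  have h2 : (t.card : ℝ) = (16 * R + 1) ^ 2 := by
    have : t.card = (16 * R + 1) ^ 2 := by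
      simp only [t, Finset.card_product, Int.card_Icc]
      have : (8 * (R : ℤ) + 1 - -(8 * R)).toNat = 16 * R + 1 := by omega
      rw [this, sq]
    rw [this]; push_cast; ring
  calc (Z.card : ℝ) ≤ ⌊K⌋₊ * t.card := by exact_mod_cast h1
    _ ≤ K * (16 * R + 1) ^ 2 := by rw [h2]; gcongr; exact Nat.floor_le hK0
    _ ≤ K * (17 * R) ^ 2 := by gcongr; linarith
    _ = 591872000000 * (R ^ 3 * logRatio a b * d ^ 4 * h ^ 2 *
      (h * Real.log (logRatio a b) * Real.log d) ^ 2) := by rw [hK]; ring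
    _ ≤ 6 * 10 ^ 11 * (R ^ 3 * logRatio a b * d ^ 4 * h ^ 2 *
      (h * Real.log (logRatio a b) * Real.log d) ^ 2) := by gcongr; norm_num
    _ = _ := by ring

/-- Finiteness comes along with the bound: an infinite set would contain finite subsets of more than
`B` elements. -/
theorem cardAtMost_of_finset {A : Set ℂ} {B : ℝ}
    (h : ∀ Z : Finset ℂ, (∀ z ∈ Z, z ∈ A) → (Z.card : ℝ) ≤ B) : CardAtMost A B := by
  have hfin : A.Finite := by
    by_contra hinf
    obtain ⟨Z, hZ, hc⟩ := Set.Infinite.exists_subset_card_eq hinf (⌊B⌋₊ + 1)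
    have h1 := h Z fun z hz => hZ hz
    rw [hc] at h1
    have h2 := Nat.lt_floor_add_one B
    push_cast at h1
    linarith
  refine ⟨hfin, ?_⟩
  rw [Set.ncard_eq_toFinset_card A hfin]
  exact h _ fun z hz => by simpa using hz

/-- The number of algebraic points at distance at least `1 / R` from the boundary. -/
theorem cardAtMost_algPoints_norm_le {f : ℂ → ℂ} {S : Set ℂ} {a b : ℝ} (hb : 1 < b)
    (hab : b ^ Real.exp 1 ≤ a) (ha : Real.exp 1 ≤ a) (hf : DecaysOn f S a b) {d R : ℕ} {H : ℝ}
    (hd : 2 ≤ d) (hH : Real.exp 1 ≤ H) (hR : 1 ≤ R) :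
    CardAtMost (algPoints f S d H ∩ {α | ‖α‖ ≤ 1 - 1 / R})
      (10 ^ 13 * R ^ 3 * logRatio a b * Real.log (logRatio a b) ^ 2 * d ^ 4 * Real.log d ^ 2 *
        Real.log H ^ 4) := by
  obtain ⟨hle, -, -, -⟩ := logRatio_estimates hb hab ha
  have hl0 : 0 < logRatio a b := (Real.exp_pos 1).trans_le hle
  have hH0 : 0 < H := (Real.exp_pos 1).trans_le hH
  have hlH : 1 ≤ Real.log H := by rwa [Real.le_log_iff_exp_le hH0]
  -- Since `log 4 ≥ 1`, this gives `H ≤ 4 ^ h`; since `log H ≥ 1`, rounding up at most doubles, so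
  -- `h ^ 4` costs a factor `16`.
  set h := ⌈Real.log H⌉₊
  have hh1 : Real.log H ≤ h := Nat.le_ceil _
  have hh2 : (h : ℝ) ≤ 2 * Real.log H := by
    have := Nat.ceil_lt_add_one (zero_le_one.trans hlH)
    linarith
  have hh : 1 ≤ h := by exact_mod_cast hlH.trans hh1
  have hH4 : H ≤ 4 ^ h := by
    have h1 : Real.log H ≤ Real.log (4 ^ h) := by
      rw [Real.log_pow]
      have : 1 ≤ Real.log 4 := by
        rw [show (4 : ℝ) = 2 ^ 2 by norm_num, Real.log_pow]
        push_cast; linarith [Real.log_two_gt_d9]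
      nlinarith
    exact (Real.log_le_log_iff hH0 (by positivity)).1 h1
  refine cardAtMost_of_finset fun Z hZ => ?_
  refine (card_algPoints_finset_le hb hab ha hf hd hh hR Z fun z hz => ?_).trans ?_
  · obtain ⟨⟨c0, c1, c2, c3, c4, c5, c6⟩, c7⟩ := hZ z hz
    exact ⟨⟨c0, c1, c2, c3, c4, c5.trans hH4, c6.trans hH4⟩, c7⟩
  · calc _ = 6 * 10 ^ 11 * (R ^ 3 * logRatio a b * Real.log (logRatio a b) ^ 2 * d ^ 4 *
          Real.log d ^ 2) * h ^ 4 := by ring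
      _ ≤ 6 * 10 ^ 11 * (R ^ 3 * logRatio a b * Real.log (logRatio a b) ^ 2 * d ^ 4 *
          Real.log d ^ 2) * (2 * Real.log H) ^ 4 := by gcongr
      _ = 96 * 10 ^ 11 * (R ^ 3 * logRatio a b * Real.log (logRatio a b) ^ 2 * d ^ 4 *
          Real.log d ^ 2 * Real.log H ^ 4) := by ring
      _ ≤ 10 ^ 13 * (R ^ 3 * logRatio a b * Real.log (logRatio a b) ^ 2 * d ^ 4 *
          Real.log d ^ 2 * Real.log H ^ 4) := by gcongr; norm_num
      _ = _ := by ring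

/-- The bound for all algebraic points, with explicit dependence on `a` and `b`. -/
theorem cardAtMost_algPoints {f : ℂ → ℂ} {S : Set ℂ} {a b : ℝ} (hb : 1 < b)
    (hab : b ^ Real.exp 1 ≤ a) (ha : Real.exp 1 ≤ a) (hf : DecaysOn f S a b) {d : ℕ} {H : ℝ}
    (hd : 2 ≤ d) (hH : Real.exp 1 ≤ H) :
    CardAtMost (algPoints f S d H)
      (10 ^ 15 * logRatio a b ^ 6 * Real.log (logRatio a b) ^ 3 * d ^ 9 * Real.log d ^ 2 *
        Real.log H ^ 9) := by
  obtain ⟨hle, hll, hlb1, hla⟩ := logRatio_estimates hb hab ha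
  have hlb : 0 < Real.log b := Real.log_pos hb
  have ha0 : 0 < a := (Real.exp_pos 1).trans_le ha
  have hH0 : 0 < H := (Real.exp_pos 1).trans_le hH
  have hlH : 1 ≤ Real.log H := by rwa [Real.le_log_iff_exp_le hH0]
  have hH1 : 1 ≤ H := by linarith [Real.add_one_le_exp (1 : ℝ)]
  set l := logRatio a b
  have hl1 : 1 ≤ l := by linarith [Real.add_one_le_exp (1 : ℝ)]
  have hdr : (2 : ℝ) ≤ d := by exact_mod_cast hd
  have hdl : 1 ≤ d * l * Real.log H := by
    have : 1 ≤ d * l := by nlinarith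
    nlinarith
  set R := ⌈3 * (d * l * Real.log H)⌉₊
  have hR1 : 3 * (d * l * Real.log H) ≤ R := Nat.le_ceil _
  have hR2 : (R : ℝ) ≤ 4 * (d * l * Real.log H) := by
    have := Nat.ceil_lt_add_one (a := 3 * (d * l * Real.log H)) (by positivity)
    linarith
  have hRr : (1 : ℝ) ≤ R := by linarith
  have hR : 1 ≤ R := by exact_mod_cast hRr
  have hmain := cardAtMost_algPoints_norm_le hb hab ha hf hd hH hR
  -- No counted point is close to the unit circle: comparing `‖f α‖ ≥ H ^ (-2d)` with the decay on
  -- `S` gives `diskPhi α * log b ≤ 2 * d * log H + log a`, and both terms are absorbed into `3 * d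
  -- * l * log H * log b`.
  have heq : algPoints f S d H ∩ {α | ‖α‖ ≤ 1 - 1 / R} = algPoints f S d H := by
    refine Set.inter_eq_left.2 fun α hα => ?_
    obtain ⟨c0, c1, c2, c3, c4, c5, c6⟩ := hα
    have h1 := one_le_height_pow_mul_norm c1 c2 c4 hH1 c5 c6 c3
    have hα1 : ‖α‖ < 1 := by simpa using hf.subset_disk c0
    have h2 := hf.decay α c0
    have hφ : 0 < diskPhi α := by rw [diskPhi]; exact one_div_pos.2 (by linarith)
    have h3 : 1 ≤ H ^ (2 * d) * (a * b ^ (-diskPhi α)) := h1.trans (by gcongr)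
    have hbpos : 0 < b ^ (-diskPhi α) := Real.rpow_pos_of_pos (by linarith) _
    have h4 := Real.log_le_log one_pos h3
    rw [Real.log_one, Real.log_mul (by positivity) (by positivity), Real.log_pow,
      Real.log_mul ha0.ne' hbpos.ne', Real.log_rpow (by linarith), ← hla] at h4
    push_cast at h4
    have h5 : diskPhi α * Real.log b ≤ (3 * (d * l * Real.log H)) * Real.log b := by
      have e1 : 2 * d * Real.log H ≤ 2 * d * Real.log H * (l * Real.log b) :=
        le_mul_of_one_le_right (by positivity) hlb1
      have e2 : l * Real.log b ≤ (d * Real.log H) * (l * Real.log b) :=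
        le_mul_of_one_le_left (by linarith) (by nlinarith)
      nlinarith
    have h6 : diskPhi α ≤ R := (le_of_mul_le_mul_right h5 hlb).trans hR1
    rw [diskPhi] at h6
    have h7 : 1 / (R : ℝ) ≤ 1 - ‖α‖ := by
      rw [div_le_iff₀ (by linarith)] at h6 ⊢
      linarith
    change ‖α‖ ≤ 1 - 1 / R
    linarith
  rw [heq] at hmain
  refine ⟨hmain.1, hmain.2.trans ?_⟩
  set lg := Real.log l
  have hlg0 : 0 ≤ lg := by linarith
  -- Inserting `R` yields exponents `4`, `2`, `7`, `7` for `l`, `log l`, `d`, `log H`; they are then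
  -- relaxed to `6`, `3`, `9`, `9`.
  calc 10 ^ 13 * (R : ℝ) ^ 3 * l * lg ^ 2 * d ^ 4 * Real.log d ^ 2 * Real.log H ^ 4
      ≤ 10 ^ 13 * (4 * (d * l * Real.log H)) ^ 3 * l * lg ^ 2 * d ^ 4 * Real.log d ^ 2 *
          Real.log H ^ 4 := by gcongr
    _ = 64 * 10 ^ 13 * l ^ 4 * lg ^ 2 * d ^ 7 * Real.log d ^ 2 * Real.log H ^ 7 := by ring
    _ ≤ 10 ^ 15 * l ^ 6 * lg ^ 3 * d ^ 9 * Real.log d ^ 2 * Real.log H ^ 9 := by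
        gcongr
        · norm_num
        · norm_num
        · norm_num
        · linarith
        · norm_num
        · norm_num

/-! ### Effective computability of the constants. -/

/-- The fraction coded by a pair of natural numbers. -/
noncomputable def natFrac (c : ℕ × ℕ) : ℝ := (c.1 : ℝ) / ((c.2 : ℝ) + 1)

/-- A sequence of rational intervals that shrinks to a positive real number. -/
noncomputable def shrinkingInterval (y : ℝ) (N : ℕ) : IntervalCode :=
  ((⌈y * (N + 1)⌉₊ - 1, 0, N), (⌊y * (N + 1)⌋₊ + 1, 0, N))

/-- `M` has enclosures, primitive recursive in the codes of boxes, which converge along the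
boxes formed by the shrinking intervals. -/
def HasPrimrecEnclosure {n : ℕ} (D : Set (Fin n → ℝ)) (M : (Fin n → ℝ) → ℝ) : Prop :=
  ∃ (cond : (Fin n → IntervalCode) → Prop) (lo hi : (Fin n → IntervalCode) → ℕ × ℕ),
    PrimrecPred cond ∧ Primrec lo ∧ Primrec hi ∧
    (∀ B, cond B → ∀ x ∈ D, (∀ i, x i ∈ IntervalCode.toSet (B i)) →
      natFrac (lo B) < M x ∧ M x < natFrac (hi B)) ∧
    ∀ x ∈ D, (∀ᶠ N in Filter.atTop, cond fun i => shrinkingInterval (x i) N) ∧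
      Filter.Tendsto (fun N => natFrac (lo fun i => shrinkingInterval (x i) N)) Filter.atTop
        (nhds (M x)) ∧
      Filter.Tendsto (fun N => natFrac (hi fun i => shrinkingInterval (x i) N)) Filter.atTop
        (nhds (M x))

theorem mem_shrinkingInterval {y : ℝ} (hy : 0 < y) (N : ℕ) :
    y ∈ IntervalCode.toSet (shrinkingInterval y N) := by
  have hN : (0 : ℝ) < N + 1 := by positivity
  -- As `y > 0`, the ceiling is at least `1` and the natural subtraction of `1` is exact. Ceiling
  -- minus one and floor plus one keep both endpoints strictly away from `y`.
  have h1 : 0 < ⌈y * (N + 1)⌉₊ := Nat.ceil_pos.2 (by positivity)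
  simp only [IntervalCode.toSet, shrinkingInterval, RatCode.val, Set.mem_Ioo, Nat.cast_zero,
    sub_zero]
  constructor
  · rw [div_lt_iff₀ hN, Nat.cast_sub h1, Nat.cast_one]
    linarith [Nat.ceil_lt_add_one (a := y * (N + 1)) (by positivity)]
  · rw [lt_div_iff₀ hN]
    push_cast
    exact Nat.lt_floor_add_one _

open Filter Topology in
theorem tendsto_shrinkingInterval {y : ℝ} (hy : 0 < y) :
    Tendsto (fun N => RatCode.val (shrinkingInterval y N).1) atTop (𝓝 y) ∧
      Tendsto (fun N => RatCode.val (shrinkingInterval y N).2) atTop (𝓝 y) := by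
  have hlim : Tendsto (fun N : ℕ => 1 / ((N : ℝ) + 1)) atTop (𝓝 0) :=
    tendsto_one_div_add_atTop_nhds_zero_nat
  have hd : ∀ N : ℕ, y - 1 / ((N : ℝ) + 1) ≤ RatCode.val (shrinkingInterval y N).1 ∧
      RatCode.val (shrinkingInterval y N).2 ≤ y + 1 / ((N : ℝ) + 1) := by
    intro N
    have hN : (0 : ℝ) < N + 1 := by positivity
    have h1 : 0 < ⌈y * (N + 1)⌉₊ := Nat.ceil_pos.2 (by positivity)
    simp only [shrinkingInterval, RatCode.val, Nat.cast_zero, sub_zero]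
    constructor
    · rw [le_div_iff₀ hN, Nat.cast_sub h1, Nat.cast_one, sub_mul, one_div_mul_cancel hN.ne']
      linarith [Nat.le_ceil (y * ((N : ℝ) + 1))]
    · rw [div_le_iff₀ hN, add_mul, one_div_mul_cancel hN.ne']
      push_cast
      linarith [Nat.floor_le (a := y * ((N : ℝ) + 1)) (by positivity)]
  have hlo : Tendsto (fun N : ℕ => y - 1 / ((N : ℝ) + 1)) atTop (𝓝 y) := by
    simpa using hlim.const_sub y
  have hhi : Tendsto (fun N : ℕ => y + 1 / ((N : ℝ) + 1)) atTop (𝓝 y) := by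
    simpa using hlim.const_add y
  exact ⟨tendsto_of_tendsto_of_tendsto_of_le_of_le hlo tendsto_const_nhds (fun N => (hd N).1)
      fun N => (mem_shrinkingInterval hy N).1.le,
    tendsto_of_tendsto_of_tendsto_of_le_of_le tendsto_const_nhds hhi
      (fun N => (mem_shrinkingInterval hy N).2.le) fun N => (hd N).2⟩

theorem RatCode.val_eq_natFrac {c : RatCode} (h : c.2.1 = 0) : c.val = natFrac (c.1, c.2.2) := by
  simp [RatCode.val, natFrac, h]

theorem primrec_box_apply {n : ℕ} (i : Fin n) :
    Primrec fun B : Fin n → IntervalCode => B i :=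
  Primrec.fin_app.comp Primrec.id (Primrec.const i)

/-- Only endpoints coded without a subtracted part are used, so all arithmetic takes place on
natural fractions; the shrinking intervals have this shape. -/
theorem primrecPred_nonneg_codes {n : ℕ} (i : Fin n) :
    PrimrecPred fun B : Fin n → IntervalCode => (B i).1.2.1 = 0 ∧ (B i).2.2.1 = 0 := by
  have h := primrec_box_apply i
  exact (Primrec.eq.comp (Primrec.fst.comp (Primrec.snd.comp (Primrec.fst.comp h)))
    (Primrec.const 0)).and
    (Primrec.eq.comp (Primrec.fst.comp (Primrec.snd.comp (Primrec.snd.comp h))) (Primrec.const 0))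

theorem HasPrimrecEnclosure.coord {n : ℕ} {D : Set (Fin n → ℝ)} (i : Fin n)
    (hD : ∀ x ∈ D, 0 < x i) : HasPrimrecEnclosure D fun x => x i := by
  have h := primrec_box_apply i
  refine ⟨fun B => (B i).1.2.1 = 0 ∧ (B i).2.2.1 = 0, fun B => ((B i).1.1, (B i).1.2.2),
    fun B => ((B i).2.1, (B i).2.2.2), primrecPred_nonneg_codes i, ?_, ?_, ?_, ?_⟩
  · exact Primrec.pair (Primrec.fst.comp (Primrec.fst.comp h))
      (Primrec.snd.comp (Primrec.snd.comp (Primrec.fst.comp h)))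
  · exact Primrec.pair (Primrec.fst.comp (Primrec.snd.comp h))
      (Primrec.snd.comp (Primrec.snd.comp (Primrec.snd.comp h)))
  · intro B hB x hx hmem
    rw [← RatCode.val_eq_natFrac hB.1, ← RatCode.val_eq_natFrac hB.2]
    exact hmem i
  · intro x hx
    obtain ⟨h1, h2⟩ := tendsto_shrinkingInterval (hD x hx)
    refine ⟨Filter.Eventually.of_forall fun N => ⟨rfl, rfl⟩, ?_, ?_⟩
    · exact h1.congr fun N => RatCode.val_eq_natFrac rfl
    · exact h2.congr fun N => RatCode.val_eq_natFrac rfl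

/-- The inverse of `p / (s + 1) - 1` is `(s + 1) / (p - s - 1)`; codes store the denominator minus
one, hence `p - s - 2`. The hypothesis makes the truncated subtraction exact. -/
theorem natFrac_inv_sub_one {p s : ℕ} (h : s + 1 < p) :
    natFrac (s + 1, p - s - 2) = 1 / (natFrac (p, s) - 1) := by
  obtain ⟨k, rfl⟩ := Nat.exists_eq_add_of_lt h
  have : s + 1 + k + 1 - s - 2 = k := by omega
  rw [this]
  simp only [natFrac]
  push_cast
  have h2 : (s : ℝ) + 1 ≠ 0 := by positivity
  have h1 : ((s : ℝ) + 1 + k + 1) / (s + 1) - 1 = (k + 1) / (s + 1) := by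
    field_simp; ring
  rw [h1, one_div_div]

theorem natFrac_inv_one_sub {p s : ℕ} (h : p < s + 1) :
    natFrac (s + 1, s - p) = 1 / (1 - natFrac (p, s)) := by
  obtain ⟨k, rfl⟩ := Nat.exists_eq_add_of_le (Nat.lt_succ_iff.1 h)
  rw [Nat.add_sub_cancel_left]
  simp only [natFrac]
  push_cast
  have h2 : (p : ℝ) + k + 1 ≠ 0 := by positivity
  have h1 : 1 - (p : ℝ) / (p + k + 1) = (k + 1) / (p + k + 1) := by
    field_simp; ring
  rw [h1, one_div_div]

theorem one_lt_natFrac {p s : ℕ} : 1 < natFrac (p, s) ↔ s + 1 < p := by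
  rw [natFrac, one_lt_div (by positivity)]
  exact_mod_cast Iff.rfl

theorem natFrac_lt_one {p s : ℕ} : natFrac (p, s) < 1 ↔ p < s + 1 := by
  rw [natFrac, div_lt_one (by positivity)]
  exact_mod_cast Iff.rfl

-- `1 / (x - 1)` is decreasing, so upper and lower endpoints swap. The condition that the lower
-- endpoint exceeds `1` makes the upper bound meaningful and holds eventually.
open Filter in
theorem HasPrimrecEnclosure.inv_coord_sub_one {n : ℕ} {D : Set (Fin n → ℝ)} (i : Fin n)
    (hD : ∀ x ∈ D, 1 < x i) : HasPrimrecEnclosure D fun x => 1 / (x i - 1) := by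
  have h := primrec_box_apply i
  have hp1 := Primrec.fst.comp (Primrec.fst.comp h)
  have hs1 := Primrec.snd.comp (Primrec.snd.comp (Primrec.fst.comp h))
  have hp2 := Primrec.fst.comp (Primrec.snd.comp h)
  have hs2 := Primrec.snd.comp (Primrec.snd.comp (Primrec.snd.comp h))
  refine ⟨fun B => ((B i).1.2.1 = 0 ∧ (B i).2.2.1 = 0) ∧ (B i).1.2.2 + 1 < (B i).1.1,
    fun B => ((B i).2.2.2 + 1, (B i).2.1 - (B i).2.2.2 - 2),
    fun B => ((B i).1.2.2 + 1, (B i).1.1 - (B i).1.2.2 - 2),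
    (primrecPred_nonneg_codes i).and (Primrec.nat_lt.comp (Primrec.succ.comp hs1) hp1),
    Primrec.pair (Primrec.succ.comp hs2)
      (Primrec.nat_sub.comp (Primrec.nat_sub.comp hp2 hs2) (Primrec.const 2)),
    Primrec.pair (Primrec.succ.comp hs1)
      (Primrec.nat_sub.comp (Primrec.nat_sub.comp hp1 hs1) (Primrec.const 2)), ?_, ?_⟩
  · rintro B ⟨hB, hlt⟩ x hx hmem
    have h1 := (hmem i).1
    have h2 := (hmem i).2
    rw [RatCode.val_eq_natFrac hB.1] at h1
    rw [RatCode.val_eq_natFrac hB.2] at h2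
    have h3 := one_lt_natFrac.2 hlt
    have h4 := (hD x hx).trans h2
    rw [natFrac_inv_sub_one hlt, natFrac_inv_sub_one (one_lt_natFrac.1 h4)]
    have h5 := hD x hx
    constructor
    · exact one_div_lt_one_div_of_lt (by linarith) (by linarith)
    · exact one_div_lt_one_div_of_lt (by linarith) (by linarith)
  · intro x hx
    have hx1 := hD x hx
    have hx0 : 0 < x i := by linarith
    obtain ⟨h1, h2⟩ := tendsto_shrinkingInterval hx0
    have hev : ∀ᶠ N in Filter.atTop, (shrinkingInterval (x i) N).1.2.2 + 1 <
        (shrinkingInterval (x i) N).1.1 := by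
      filter_upwards [h1.eventually (lt_mem_nhds hx1)] with N hN
      rw [RatCode.val_eq_natFrac rfl] at hN
      exact one_lt_natFrac.1 hN
    have hne : x i - 1 ≠ 0 := by linarith
    refine ⟨hev.mono fun N hN => ⟨⟨rfl, rfl⟩, hN⟩, ?_, ?_⟩
    · refine (tendsto_const_nhds.div (h2.sub_const 1) hne).congr fun N => ?_
      have h3 := hx1.trans (mem_shrinkingInterval hx0 N).2
      rw [RatCode.val_eq_natFrac rfl] at h3
      rw [Pi.div_apply, RatCode.val_eq_natFrac rfl]
      exact (natFrac_inv_sub_one (one_lt_natFrac.1 h3)).symm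
    · refine (tendsto_const_nhds.div (h1.sub_const 1) hne).congr' ?_
      filter_upwards [hev] with N hN
      rw [Pi.div_apply, RatCode.val_eq_natFrac rfl]
      exact (natFrac_inv_sub_one hN).symm

open Filter in
theorem HasPrimrecEnclosure.inv_one_sub_coord {n : ℕ} {D : Set (Fin n → ℝ)} (i : Fin n)
    (hD : ∀ x ∈ D, 0 < x i ∧ x i < 1) : HasPrimrecEnclosure D fun x => 1 / (1 - x i) := by
  have h := primrec_box_apply i
  have hp1 := Primrec.fst.comp (Primrec.fst.comp h)
  have hs1 := Primrec.snd.comp (Primrec.snd.comp (Primrec.fst.comp h))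
  have hp2 := Primrec.fst.comp (Primrec.snd.comp h)
  have hs2 := Primrec.snd.comp (Primrec.snd.comp (Primrec.snd.comp h))
  refine ⟨fun B => ((B i).1.2.1 = 0 ∧ (B i).2.2.1 = 0) ∧ (B i).2.1 < (B i).2.2.2 + 1,
    fun B => ((B i).1.2.2 + 1, (B i).1.2.2 - (B i).1.1),
    fun B => ((B i).2.2.2 + 1, (B i).2.2.2 - (B i).2.1),
    (primrecPred_nonneg_codes i).and (Primrec.nat_lt.comp hp2 (Primrec.succ.comp hs2)),
    Primrec.pair (Primrec.succ.comp hs1) (Primrec.nat_sub.comp hs1 hp1),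
    Primrec.pair (Primrec.succ.comp hs2) (Primrec.nat_sub.comp hs2 hp2), ?_, ?_⟩
  · rintro B ⟨hB, hlt⟩ x hx hmem
    have h1 := (hmem i).1
    have h2 := (hmem i).2
    rw [RatCode.val_eq_natFrac hB.1] at h1
    rw [RatCode.val_eq_natFrac hB.2] at h2
    have h3 := natFrac_lt_one.2 hlt
    have h5 := (hD x hx).2
    have h4 := h1.trans h5
    rw [natFrac_inv_one_sub hlt, natFrac_inv_one_sub (natFrac_lt_one.1 h4)]
    constructor
    · exact one_div_lt_one_div_of_lt (by linarith) (by linarith)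
    · exact one_div_lt_one_div_of_lt (by linarith) (by linarith)
  · intro x hx
    obtain ⟨hx0, hx1⟩ := hD x hx
    obtain ⟨h1, h2⟩ := tendsto_shrinkingInterval hx0
    have hev : ∀ᶠ N in Filter.atTop, (shrinkingInterval (x i) N).2.1 <
        (shrinkingInterval (x i) N).2.2.2 + 1 := by
      filter_upwards [h2.eventually (gt_mem_nhds hx1)] with N hN
      rw [RatCode.val_eq_natFrac rfl] at hN
      exact natFrac_lt_one.1 hN
    have hne : 1 - x i ≠ 0 := by linarith
    refine ⟨hev.mono fun N hN => ⟨⟨rfl, rfl⟩, hN⟩, ?_, ?_⟩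
    · refine (tendsto_const_nhds.div (h1.const_sub 1) hne).congr fun N => ?_
      have h3 := (mem_shrinkingInterval hx0 N).1.trans hx1
      rw [RatCode.val_eq_natFrac rfl] at h3
      rw [Pi.div_apply, RatCode.val_eq_natFrac rfl]
      exact (natFrac_inv_one_sub (natFrac_lt_one.1 h3)).symm
    · refine (tendsto_const_nhds.div (h2.const_sub 1) hne).congr' ?_
      filter_upwards [hev] with N hN
      rw [Pi.div_apply, RatCode.val_eq_natFrac rfl]
      exact (natFrac_inv_one_sub hN).symm

theorem natFrac_add (p s p' s' : ℕ) :
    natFrac (p * (s' + 1) + p' * (s + 1), (s + 1) * (s' + 1) - 1) =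
      natFrac (p, s) + natFrac (p', s') := by
  have h : (((s + 1) * (s' + 1) - 1 : ℕ) : ℝ) + 1 = (s + 1) * (s' + 1) := by
    rw [Nat.cast_sub (Nat.one_le_iff_ne_zero.2 (by positivity))]; push_cast; ring
  simp only [natFrac]
  rw [h, div_add_div _ _ (by positivity) (by positivity)]
  push_cast
  ring

theorem HasPrimrecEnclosure.add {n : ℕ} {D : Set (Fin n → ℝ)} {M M' : (Fin n → ℝ) → ℝ}
    (hM : HasPrimrecEnclosure D M) (hM' : HasPrimrecEnclosure D M') :
    HasPrimrecEnclosure D fun x => M x + M' x := by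
  obtain ⟨c, lo, hi, hc, hlo, hhi, hs, ht⟩ := hM
  obtain ⟨c', lo', hi', hc', hlo', hhi', hs', ht'⟩ := hM'
  have hadd : ∀ {u v : (Fin n → IntervalCode) → ℕ × ℕ}, Primrec u → Primrec v →
      Primrec fun B => ((u B).1 * ((v B).2 + 1) + (v B).1 * ((u B).2 + 1),
        ((u B).2 + 1) * ((v B).2 + 1) - 1) := by
    intro u v hu hv
    have a1 := Primrec.fst.comp hu
    have a2 := Primrec.succ.comp (Primrec.snd.comp hu)
    have b1 := Primrec.fst.comp hv
    have b2 := Primrec.succ.comp (Primrec.snd.comp hv)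
    exact Primrec.pair (Primrec.nat_add.comp (Primrec.nat_mul.comp a1 b2)
      (Primrec.nat_mul.comp b1 a2))
      (Primrec.nat_sub.comp (Primrec.nat_mul.comp a2 b2) (Primrec.const 1))
  refine ⟨fun B => c B ∧ c' B, _, _, hc.and hc', hadd hlo hlo', hadd hhi hhi', ?_, ?_⟩
  · rintro B ⟨h1, h2⟩ x hx hmem
    have e1 := hs B h1 x hx hmem
    have e2 := hs' B h2 x hx hmem
    rw [natFrac_add, natFrac_add]
    exact ⟨add_lt_add e1.1 e2.1, add_lt_add e1.2 e2.2⟩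
  · intro x hx
    obtain ⟨h1, h2, h3⟩ := ht x hx
    obtain ⟨h1', h2', h3'⟩ := ht' x hx
    refine ⟨h1.and h1', ?_, ?_⟩
    · simp_rw [natFrac_add]; exact h2.add h2'
    · simp_rw [natFrac_add]; exact h3.add h3'

-- The enumerated set is the graph of a primitive recursive map, box to enclosure, restricted to the
-- decidable condition. Strict monotonicity of `C * t ^ K` on `t ≥ 0`, which needs `C` and `K`
-- nonzero, transports the open enclosure.
open Filter Topology in
theorem HasPrimrecEnclosure.effectivelyComputableOn {n : ℕ} {D : Set (Fin n → ℝ)}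
    {M : (Fin n → ℝ) → ℝ} (hM : HasPrimrecEnclosure D M) (hD : ∀ x ∈ D, ∀ i, 0 < x i)
    {C K : ℕ} (hC : C ≠ 0) (hK : K ≠ 0) :
    EffectivelyComputableOn D fun x => C * M x ^ K := by
  obtain ⟨c, lo, hi, hc, hlo, hhi, hs, ht⟩ := hM
  let code : ℕ × ℕ → RatCode := fun u => (C * u.1 ^ K, 0, (u.2 + 1) ^ K - 1)
  have hpow : Primrec fun m : ℕ => m ^ K := by
    induction K with
    | zero => simpa using Primrec.const 1
    | succ K ih =>
      rcases eq_or_ne K 0 with rfl | hK0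
      · simpa using! (Primrec.id : Primrec (id : ℕ → ℕ))
      · simpa [pow_succ] using Primrec.nat_mul.comp (ih hK0) Primrec.id
  have hcode : Primrec code :=
    Primrec.pair (Primrec.nat_mul.comp (Primrec.const C) (hpow.comp Primrec.fst))
      (Primrec.pair (Primrec.const 0) (Primrec.nat_sub.comp
        (hpow.comp (Primrec.succ.comp Primrec.snd)) (Primrec.const 1)))
  have hval : ∀ u, (code u).val = C * natFrac u ^ K := by
    intro u
    have h : (((u.2 + 1) ^ K - 1 : ℕ) : ℝ) + 1 = (u.2 + 1) ^ K := by
      rw [Nat.cast_sub (Nat.one_le_pow _ _ (by omega))]; push_cast; ring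
    simp only [RatCode.val, code, natFrac, h]
    push_cast
    rw [div_pow, sub_zero, mul_div_assoc]
  have hnn : ∀ u, 0 ≤ natFrac u := fun u => by unfold natFrac; positivity
  have hCr : (0 : ℝ) < C := by positivity
  refine ⟨fun P => c P.1 ∧ P.2 = (code (lo P.1), code (hi P.1)), ?_, ?_, ?_⟩
  · have hp : PrimrecPred fun P : (Fin n → IntervalCode) × IntervalCode =>
        c P.1 ∧ P.2 = (code (lo P.1), code (hi P.1)) :=
      (hc.comp Primrec.fst).and (Primrec.eq.comp Primrec.snd
        (Primrec.pair (hcode.comp (hlo.comp Primrec.fst)) (hcode.comp (hhi.comp Primrec.fst))))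
    exact hp.computablePred.to_re
  · rintro B J ⟨hB, hJ⟩ x hx hmem
    simp only at hB hJ
    subst hJ
    obtain ⟨h1, h2⟩ := hs B hB x hx hmem
    simp only [IntervalCode.toSet, hval, Set.mem_Ioo]
    have h0 := hnn (lo B)
    constructor
    · gcongr
    · have : 0 ≤ M x := h0.trans h1.le
      gcongr
  · intro x hx ε hε
    obtain ⟨h1, h2, h3⟩ := ht x hx
    have h4 : Tendsto (fun N => (code (hi fun i => shrinkingInterval (x i) N)).val -
        (code (lo fun i => shrinkingInterval (x i) N)).val) atTop (𝓝 0) := by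
      simp_rw [hval]
      have := ((h3.pow K).const_mul (C : ℝ)).sub ((h2.pow K).const_mul (C : ℝ))
      rwa [sub_self] at this
    obtain ⟨N, hN1, hN2⟩ := (h1.and (h4.eventually (gt_mem_nhds hε))).exists
    exact ⟨fun i => shrinkingInterval (x i) N,
      (code (lo fun i => shrinkingInterval (x i) N), code (hi fun i => shrinkingInterval (x i) N)),
      ⟨hN1, Eq.refl _⟩, fun i => mem_shrinkingInterval (hD x hx i) N, hN2⟩

/-- The intervals are `c ± 1 / (N + 1)`, with `N` read off from the code itself, so membership is a
decidable equation. The subtracted part of the code makes the lower endpoint correct for `c = 0` as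
well. -/
theorem effectivelyComputableReal_natCast (c : ℕ) : EffectivelyComputableReal c := by
  refine ⟨fun P => P.2 = ((c * (P.2.1.2.2 + 1), 1, P.2.1.2.2),
    (c * (P.2.1.2.2 + 1) + 1, 0, P.2.1.2.2)), ?_, ?_, ?_⟩
  · have hk : Primrec fun P : (Fin 0 → IntervalCode) × IntervalCode => P.2.1.2.2 :=
      Primrec.snd.comp (Primrec.snd.comp (Primrec.fst.comp Primrec.snd))
    have hm := Primrec.nat_mul.comp (Primrec.const c) (Primrec.succ.comp hk)
    have hp : PrimrecPred fun P : (Fin 0 → IntervalCode) × IntervalCode =>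
        P.2 = ((c * (P.2.1.2.2 + 1), 1, P.2.1.2.2), (c * (P.2.1.2.2 + 1) + 1, 0, P.2.1.2.2)) :=
      Primrec.eq.comp Primrec.snd (Primrec.pair
        (Primrec.pair hm (Primrec.pair (Primrec.const 1) hk))
        (Primrec.pair (Primrec.succ.comp hm) (Primrec.pair (Primrec.const 0) hk)))
    exact hp.computablePred.to_re
  · intro B J hJ x _ _
    simp only at hJ
    rw [hJ]
    have hN : (0 : ℝ) < (J.1.2.2 : ℝ) + 1 := by positivity
    simp only [IntervalCode.toSet, RatCode.val, Set.mem_Ioo]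
    rw [div_lt_iff₀ hN, lt_div_iff₀ hN]
    push_cast
    constructor <;> linarith
  · intro x _ ε hε
    obtain ⟨N, hN⟩ := exists_nat_one_div_lt (half_pos hε)
    refine ⟨fun i => i.elim0, ((c * (N + 1), 1, N), (c * (N + 1) + 1, 0, N)), Eq.refl _,
      fun i => i.elim0, ?_⟩
    simp only [RatCode.val]
    push_cast
    have h1 : (0 : ℝ) < (N : ℝ) + 1 := by positivity
    have h2 : ((c : ℝ) * (N + 1) + 1 - 0) / (N + 1) - ((c : ℝ) * (N + 1) - 1) / (N + 1) =
        2 * (1 / ((N : ℝ) + 1)) := by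
      field_simp; ring
    rw [h2]
    linarith

/-! ### Arbitrary `a` and `b`, and the final statement. -/

theorem DecaysOn.mono {f : ℂ → ℂ} {S : Set ℂ} {a a' b : ℝ} (hb : 1 < b) (haa : a ≤ a')
    (hf : DecaysOn f S a b) : DecaysOn f S a' b where
  analytic := hf.analytic
  norm_le_one := hf.norm_le_one
  subset_disk := hf.subset_disk
  interval_subset := hf.interval_subset
  decay z hz := (hf.decay z hz).trans
    (mul_le_mul_of_nonneg_right haa (Real.rpow_nonneg (by linarith) _))

theorem CardAtMost.mono {A A' : Set ℂ} {B B' : ℝ} (hA : CardAtMost A B) (hAA : A' ⊆ A)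
    (hB : B ≤ B') : CardAtMost A' B' :=
  ⟨hA.1.subset hAA, (Nat.cast_le.2 (Set.ncard_le_ncard hAA hA.1)).trans (hA.2.trans hB)⟩

/-- Enlarging `a` so that the explicit bounds apply. -/
theorem enlarged_estimates {a b M : ℝ} (ha : 0 < a) (hb : 1 < b) (hM : a + b + 1 / (b - 1) ≤ M) :
    b ^ Real.exp 1 ≤ a + 3 + b ^ 3 ∧ Real.exp 1 ≤ a + 3 + b ^ 3 ∧ 3 ≤ M ∧
      logRatio (a + 3 + b ^ 3) b ≤ M ^ 5 := by
  have he : Real.exp 1 ≤ 3 := by linarith [Real.exp_one_lt_d9]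
  have hb1 : 0 < b - 1 := by linarith
  have hinv : 0 < 1 / (b - 1) := by positivity
  have hb3 : 0 < b ^ 3 := by positivity
  have hamgm : 2 ≤ (b - 1) + 1 / (b - 1) := by
    have h1 : (b - 1) * (1 / (b - 1)) = 1 := by field_simp
    nlinarith [sq_nonneg ((b - 1) - 1 / (b - 1))]
  have hM3 : 3 ≤ M := by linarith
  refine ⟨?_, by linarith, hM3, ?_⟩
  · calc b ^ Real.exp 1 ≤ b ^ (3 : ℝ) := Real.rpow_le_rpow_of_exponent_le hb.le he
      _ = b ^ 3 := by exact_mod_cast Real.rpow_natCast b 3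
      _ ≤ _ := by linarith
  · have hlb : 0 < Real.log b := Real.log_pos hb
    have h1 : Real.log (a + 3 + b ^ 3) ≤ M ^ 4 := by
      have e1 : b ^ 3 ≤ M ^ 3 := by gcongr; linarith
      have e2 : M ^ 3 * 3 ≤ M ^ 3 * M := by gcongr
      have e3 : M * 1 ≤ M * M ^ 2 := by gcongr; nlinarith
      have := Real.log_le_sub_one_of_pos (x := a + 3 + b ^ 3) (by positivity)
      nlinarith
    -- `1 + 1 / (b - 1)` is the inverse of `1 - b⁻¹ ≤ log b`; this is why `M` contains `1 / (b -
    -- 1)`.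
    have h2 : 1 ≤ M * Real.log b := by
      have e1 : 1 - b⁻¹ ≤ Real.log b := Real.one_sub_inv_le_log_of_pos (by linarith)
      have e2 : (1 + 1 / (b - 1)) * (1 - b⁻¹) = 1 := by field_simp; ring
      have e3 : 0 < 1 - b⁻¹ := sub_pos.2 (inv_lt_one_of_one_lt₀ hb)
      calc 1 = (1 + 1 / (b - 1)) * (1 - b⁻¹) := e2.symm
        _ ≤ M * Real.log b := by gcongr; linarith
    rw [logRatio, div_le_iff₀ hlb]
    calc Real.log (a + 3 + b ^ 3) ≤ M ^ 4 := h1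
      _ ≤ M ^ 4 * (M * Real.log b) := le_mul_of_one_le_right (by positivity) h2
      _ = _ := by ring

/-- Enlarging `a` only weakens the decay hypothesis. Both `l` and `log l` are at most `M ^ 5`, so `l
^ 6 * (log l) ^ 3 ≤ M ^ 45`. -/
theorem cardAtMost_algPoints_of_pos {f : ℂ → ℂ} {S : Set ℂ} {a b M : ℝ} (ha : 0 < a) (hb : 1 < b)
    (hM : a + b + 1 / (b - 1) ≤ M) (hf : DecaysOn f S a b) {d : ℕ} {H : ℝ}
    (hd : 2 ≤ d) (hH : Real.exp 1 ≤ H) :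
    CardAtMost (algPoints f S d H)
      (10 ^ 15 * M ^ 45 * d ^ 9 * Real.log d ^ 2 * Real.log H ^ 9) := by
  obtain ⟨h1, h2, h3, h4⟩ := enlarged_estimates ha hb hM
  have hb3 : 0 < b ^ 3 := by positivity
  obtain ⟨e1, e2, -, -⟩ := logRatio_estimates hb h1 h2
  have hlH : 0 ≤ Real.log H := Real.log_nonneg (by linarith [Real.add_one_le_exp (1 : ℝ)])
  refine (cardAtMost_algPoints hb h1 h2 (hf.mono hb (by linarith)) hd hH).mono subset_rfl ?_
  set l := logRatio (a + 3 + b ^ 3) b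
  have hl0 : 0 < l := (Real.exp_pos 1).trans_le e1
  have hlog : Real.log l ≤ M ^ 5 := (Real.log_le_sub_one_of_pos hl0).trans (by linarith)
  calc _ ≤ 10 ^ 15 * (M ^ 5) ^ 6 * (M ^ 5) ^ 3 * d ^ 9 * Real.log d ^ 2 * Real.log H ^ 9 := by
        gcongr
    _ = _ := by ring

/-- Here `R` is about `1 / (1 - r)`, hence at most `2 * M`. The true exponent of `M` is `18`; it is
raised to `45` to match the other constant. -/
theorem cardAtMost_algPoints_norm_le_of_pos {f : ℂ → ℂ} {S : Set ℂ} {a b r M : ℝ} (ha : 0 < a)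
    (hb : 1 < b) (hr0 : 0 < r) (hr1 : r < 1) (hM : a + b + 1 / (b - 1) + 1 / (1 - r) ≤ M)
    (hf : DecaysOn f S a b) {d : ℕ} {H : ℝ} (hd : 2 ≤ d) (hH : Real.exp 1 ≤ H) :
    CardAtMost (algPoints f S d H ∩ {α | ‖α‖ ≤ r})
      (10 ^ 15 * M ^ 45 * d ^ 4 * Real.log d ^ 2 * Real.log H ^ 4) := by
  have hr : 0 < 1 - r := by linarith
  have hr' : 1 < 1 / (1 - r) := by rw [lt_div_iff₀ hr]; linarith
  obtain ⟨h1, h2, h3, h4⟩ := enlarged_estimates ha hb (M := M) (by linarith)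
  have hb3 : 0 < b ^ 3 := by positivity
  have hb1 : 0 < 1 / (b - 1) := one_div_pos.2 (by linarith)
  obtain ⟨e1, e2, -, -⟩ := logRatio_estimates hb h1 h2
  have hlH : 0 ≤ Real.log H := Real.log_nonneg (by linarith [Real.add_one_le_exp (1 : ℝ)])
  set R := ⌈1 / (1 - r)⌉₊
  have hR1 : 1 / (1 - r) ≤ R := Nat.le_ceil _
  have hR2 : (R : ℝ) ≤ 2 * M := by
    have := Nat.ceil_lt_add_one (a := 1 / (1 - r)) (by positivity)
    linarith
  have hR : 1 ≤ R := by exact_mod_cast hr'.le.trans hR1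
  have hRr : r ≤ 1 - 1 / R := by
    have h5 : (0 : ℝ) < R := by linarith
    have h6 : 1 / (R : ℝ) ≤ 1 - r := by
      rw [div_le_iff₀ hr] at hR1
      rw [div_le_iff₀ h5]; linarith
    linarith
  refine (cardAtMost_algPoints_norm_le hb h1 h2 (hf.mono hb (by linarith)) hd hH hR).mono
    (Set.inter_subset_inter_right _ fun α hα => le_trans hα hRr) ?_
  set l := logRatio (a + 3 + b ^ 3) b
  have hl0 : 0 < l := (Real.exp_pos 1).trans_le e1
  have hlog : Real.log l ≤ M ^ 5 := (Real.log_le_sub_one_of_pos hl0).trans (by linarith)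
  have hM1 : 1 ≤ M := by linarith
  calc _ ≤ 10 ^ 13 * (2 * M) ^ 3 * M ^ 5 * (M ^ 5) ^ 2 * d ^ 4 * Real.log d ^ 2 *
          Real.log H ^ 4 := by gcongr
    _ = 8 * 10 ^ 13 * M ^ 18 * d ^ 4 * Real.log d ^ 2 * Real.log H ^ 4 := by ring
    _ ≤ _ := by
        gcongr
        · norm_num
        · norm_num

theorem theorem1 :
    -- the bound with a constant effectively computable from `a` and `b`
    (∃ c : (Fin 2 → ℝ) → ℝ,
      EffectivelyComputableOn {p : Fin 2 → ℝ | 0 < p 0 ∧ 1 < p 1} c ∧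
      ∀ a b : ℝ, 0 < a → 1 < b → 0 < c ![a, b] ∧
        ∀ (f : ℂ → ℂ) (S : Set ℂ), DecaysOn f S a b →
          ∀ (d : ℕ) (H : ℝ), 2 ≤ d → Real.exp 1 ≤ H →
            CardAtMost (algPoints f S d H)
              (c ![a, b] * (d : ℝ) ^ 9 * Real.log d ^ 2 * Real.log H ^ 9)) ∧
    -- the improved bound for `|α| ≤ r`
    (∃ c : (Fin 3 → ℝ) → ℝ,
      EffectivelyComputableOn {p : Fin 3 → ℝ | 0 < p 0 ∧ 1 < p 1 ∧ 0 < p 2 ∧ p 2 < 1} c ∧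
      ∀ a b r : ℝ, 0 < a → 1 < b → 0 < r → r < 1 → 0 < c ![a, b, r] ∧
        ∀ (f : ℂ → ℂ) (S : Set ℂ), DecaysOn f S a b →
          ∀ (d : ℕ) (H : ℝ), 2 ≤ d → Real.exp 1 ≤ H →
            CardAtMost (algPoints f S d H ∩ {α | ‖α‖ ≤ r})
              (c ![a, b, r] * (d : ℝ) ^ 4 * Real.log d ^ 2 * Real.log H ^ 4)) ∧
    -- the form with explicit dependence on `a` and `b`, and an absolute constant
    (∃ c : ℝ, EffectivelyComputableReal c ∧ 0 < c ∧
      ∀ a b : ℝ, 1 < b → b ^ Real.exp 1 ≤ a → Real.exp 1 ≤ a →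
        ∀ (f : ℂ → ℂ) (S : Set ℂ), DecaysOn f S a b →
          ∀ (d : ℕ) (H : ℝ), 2 ≤ d → Real.exp (Real.exp 1) ≤ H →
            CardAtMost (algPoints f S d H)
              (c * logRatio a b ^ 6 * Real.log (logRatio a b) ^ 3 *
                (d : ℝ) ^ 9 * Real.log d ^ 2 * Real.log H ^ 9)) := by
  have hc : ((10 ^ 15 : ℕ) : ℝ) = 10 ^ 15 := by norm_num
  -- The constants are free of logarithms: they are built from coordinates, `1 / (b - 1)` and `1 /
  -- (1 - r)` by addition, a power and a natural multiple, exactly the operations with primitive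
  -- recursive enclosures.
  refine ⟨⟨fun p => ((10 ^ 15 : ℕ) : ℝ) * (p 0 + p 1 + 1 / (p 1 - 1)) ^ 45, ?_, ?_⟩,
    ⟨fun p => ((10 ^ 15 : ℕ) : ℝ) * (p 0 + p 1 + 1 / (p 1 - 1) + 1 / (1 - p 2)) ^ 45, ?_, ?_⟩,
    ((10 ^ 15 : ℕ) : ℝ), effectivelyComputableReal_natCast _, by positivity, ?_⟩
  · refine HasPrimrecEnclosure.effectivelyComputableOn
      (((HasPrimrecEnclosure.coord 0 ?_).add (HasPrimrecEnclosure.coord 1 ?_)).add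
        (HasPrimrecEnclosure.inv_coord_sub_one 1 ?_)) ?_ (by norm_num) (by norm_num)
    · exact fun x hx => hx.1
    · exact fun x hx => zero_lt_one.trans hx.2
    · exact fun x hx => hx.2
    · intro x hx i
      fin_cases i
      · exact hx.1
      · exact zero_lt_one.trans hx.2
  · intro a b ha hb
    have hb1 : 0 < b - 1 := by linarith
    simp only [Matrix.cons_val_zero, Matrix.cons_val_one]
    rw [hc]
    refine ⟨by positivity, fun f S hf d H hd hH => ?_⟩
    exact cardAtMost_algPoints_of_pos ha hb le_rfl hf hd hH
  · refine HasPrimrecEnclosure.effectivelyComputableOn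
      ((((HasPrimrecEnclosure.coord 0 ?_).add (HasPrimrecEnclosure.coord 1 ?_)).add
        (HasPrimrecEnclosure.inv_coord_sub_one 1 ?_)).add
        (HasPrimrecEnclosure.inv_one_sub_coord 2 ?_)) ?_ (by norm_num) (by norm_num)
    · exact fun x hx => hx.1
    · exact fun x hx => zero_lt_one.trans hx.2.1
    · exact fun x hx => hx.2.1
    · exact fun x hx => hx.2.2
    · intro x hx i
      fin_cases i
      · exact hx.1
      · exact zero_lt_one.trans hx.2.1
      · exact hx.2.2.1
  · intro a b r ha hb hr0 hr1
    have hb1 : 0 < b - 1 := by linarith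
    have hr : 0 < 1 - r := by linarith
    simp only [Matrix.cons_val_zero, Matrix.cons_val_one, Matrix.cons_val]
    rw [hc]
    refine ⟨by positivity, fun f S hf d H hd hH => ?_⟩
    exact cardAtMost_algPoints_norm_le_of_pos ha hb hr0 hr1 le_rfl hf hd hH
  · intro a b hb hab ha f S hf d H hd hH
    rw [hc]
    refine cardAtMost_algPoints hb hab ha hf hd (le_trans ?_ hH)
    exact Real.exp_le_exp.2 (by linarith [Real.add_one_le_exp (1 : ℝ)])
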